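/- Let $d\ge 3$, let $U=\{z\in\mathbb{Z}^d:|z_1|+\cdots+|z_d|=1\}$, and let $\Omega$ be the set of space-time environments $\omega=(\omega_{n,x})_{n\in\mathbb{Z},\,x\in\mathbb{Z}^d}$, where each $\omega_{n,x}=(\pi_{n,n+1}(x,x+z))_{z\in U}$ is a probability vector on $U$, with the product $\sigma$-algebra. Let $\mathbb{P}$ be a probability measure on $\Omega$ under which the $\omega_{n,x}$ are i.i.d. and which is uniformly elliptic: there is a constant $c>0$ such that $\mathbb{P}(\pi_{0,1}(0,z)\ge c)=1$ for every $z\in U$. For $\omega\in\Omega$ let $P^\omega_{o,o}$ be the law of the time-inhomogeneous Markov chain $(X_n)_{n\ge0}$ on $\mathbb{Z}^d$ with $X_0=0$ and $P^\omega_{o,o}(X_{n+1}=x+z\mid X_n=x)=\pi_{n,n+1}(x,x+z)$ for $z\in U$. Put $q(z)=\mathbb{E}[\pi_{0,1}(0,z)]$ for $z\in U$, $\xi_o=\sum_{z\in U}q(z)z$, $\Lambda_c(\theta)=\log\sum_{z\in U}q(z)e^{\langle\theta,z\rangle}$ for $\theta\in\mathbb{R}^d$, and let $$I_c(\xi)=\sup_{\theta\in\mathbb{R}^d}\{\langle\theta,\xi\rangle-\Lambda_c(\theta)\}\in[0,\infty]$$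 be the convex conjugate of $\Lambda_c$, which is the rate function of the averaged large deviation principle for $X_n/n$ (Cramér's theorem). **Theorem.** There is $\eta>0$ such that, with $B=\{\xi\in\mathbb{R}^d:|\xi-\xi_o|<\eta\}$, for $\mathbb{P}$-a.e. $\omega$ the laws of $X_n/n$ under $P^\omega_{o,o}$ satisfy the large deviation principle in $B$ with rate function equal to $I_c$ on $B$. That is, $I_c$ is non-negative and lower semicontinuous on $B$, and for $\mathbb{P}$-a.e. $\omega$ and every Borel set $G\subseteq B$, $$-\inf_{\xi\in G^o}I_c(\xi)\le\liminf_{n\to\infty}\frac1n\log P^\omega_{o,o}\Big(\frac{X_n}n\in G\Big)\le\limsup_{n\to\infty}\frac1n\log P^\omega_{o,o}\Big(\frac{X_n}n\in G\Big)\le-\inf_{\xi\in\bar G\cap B}I_c(\xi),$$ where $G^o$ and $\bar G$ are the interior and the closure of $G$, $\log 0=-\infty$ and $\inf\emptyset=+\infty$. -/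

import Mathlib

open MeasureTheory ProbabilityTheory Filter

noncomputable section

namespace SpaceTimeRWRE

/-- The set `U` of nearest-neighbour steps: `z ∈ ℤ^d` with `|z₁| + ⋯ + |z_d| = 1`
(see `mem_U`; the box `[-1, 1]^d` is only there to make finiteness visible). -/
def U (d : ℕ) : Finset (Fin d → ℤ) :=
  (Finset.Icc (-1) 1).filter fun z => ∑ i, |z i| = 1

theorem mem_U {d : ℕ} (z : Fin d → ℤ) : z ∈ U d ↔ ∑ i, |z i| = 1 := by
  simp only [U, Finset.mem_filter, Finset.mem_Icc, and_iff_right_iff_imp]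
  intro h
  have key : ∀ i, |z i| ≤ 1 := fun i => by
    rw [← h]
    exact Finset.single_le_sum (f := fun i => |z i|) (fun j _ => abs_nonneg _)
      (Finset.mem_univ i)
  exact ⟨fun i => (abs_le.mp (key i)).1, fun i => (abs_le.mp (key i)).2⟩

/-- The environment at one space-time point: a probability vector `(π(z))_{z ∈ U}`. -/
abbrev SiteEnv (d : ℕ) : Type := stdSimplex ℝ (U d)

/-- The space `Ω` of space-time environments `ω = (ω_{n,x})`, `n ∈ ℤ`, `x ∈ ℤ^d`, with the
product σ-algebra. The number `ω n x z` is the transition probability `π_{n,n+1}(x, x+z)`. -/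
abbrev Env (d : ℕ) : Type := ℤ → (Fin d → ℤ) → SiteEnv d

/-- The law of the position at time `n + 1` given position `x` at time `n`:
mass `π_{n,n+1}(x, x+z)` at `x + z` for each `z ∈ U`. -/
def stepMeasure {d : ℕ} (ω : Env d) (n : ℤ) (x : Fin d → ℤ) : Measure (Fin d → ℤ) :=
  ∑ z : U d, ENNReal.ofReal (ω n x z) • Measure.dirac (x + (z : Fin d → ℤ))

instance {d : ℕ} (ω : Env d) (n : ℤ) (x : Fin d → ℤ) :
    IsProbabilityMeasure (stepMeasure ω n x) := by
  constructor
  simp only [stepMeasure, Measure.finsetSum_apply, Measure.smul_apply, measure_univ,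
    smul_eq_mul, mul_one]
  rw [← ENNReal.ofReal_sum_of_nonneg fun z _ => stdSimplex.zero_le (ω n x) z,
    stdSimplex.sum_eq_one, ENNReal.ofReal_one]

/-- The transition kernel on `ℤ^d` from time `n` to time `n + 1` in the environment `ω`. -/
def stepKernel {d : ℕ} (ω : Env d) (n : ℤ) : Kernel (Fin d → ℤ) (Fin d → ℤ) where
  toFun := stepMeasure ω n
  measurable' := measurable_of_countable _

instance {d : ℕ} (ω : Env d) (n : ℤ) : IsMarkovKernel (stepKernel ω n) :=
  ⟨fun x => inferInstanceAs (IsProbabilityMeasure (stepMeasure ω n x))⟩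

/-- The law of the position after `m + 1` steps given the positions after `0, …, m` steps, for the
walk started at time `k`: it is read off at the last position, at time `k + m`. -/
def pathKernel {d : ℕ} (ω : Env d) (k : ℤ) (m : ℕ) :
    Kernel (Finset.Iic m → (Fin d → ℤ)) (Fin d → ℤ) :=
  (stepKernel ω (k + m)).comap (fun h => h ⟨m, Finset.mem_Iic.mpr le_rfl⟩)
    (measurable_pi_apply _)

instance {d : ℕ} (ω : Env d) (k : ℤ) (m : ℕ) : IsMarkovKernel (pathKernel ω k m) := by
  unfold pathKernel
  infer_instance

/-- The quenched measure `P_{k,x}^ω` on paths: the law of the Markov chain with transition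
probabilities `ω`, started at `x` at time `k`. A path is recorded by its positions `X m` after
`m = 0, 1, 2, …` steps, that is, at time `k + m`. -/
def quenched {d : ℕ} (ω : Env d) (k : ℤ) (x : Fin d → ℤ) : Measure (ℕ → (Fin d → ℤ)) :=
  Kernel.trajMeasure (X := fun _ => Fin d → ℤ) (Measure.dirac x) (pathKernel ω k)

/-- The inclusion of `ℤ^d` in Euclidean space `ℝ^d`. -/
def toReal {d : ℕ} (x : Fin d → ℤ) : EuclideanSpace ℝ (Fin d) :=
  WithLp.toLp 2 fun i => (x i : ℝ)

/-- The quenched law `P_{o,o}^ω (X_n / n ∈ ·)` of the mean velocity. -/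
def velocityLaw {d : ℕ} (ω : Env d) (n : ℕ) : Measure (EuclideanSpace ℝ (Fin d)) :=
  (quenched ω 0 0).map fun X => (n : ℝ)⁻¹ • toReal (X n)

theorem measurable_velocity {d : ℕ} (n : ℕ) :
    Measurable fun X : ℕ → (Fin d → ℤ) => (n : ℝ)⁻¹ • toReal (X n) :=
  (measurable_of_countable fun x : Fin d → ℤ => (n : ℝ)⁻¹ • toReal x).comp
    (measurable_pi_apply n)

/-- The mean transition vector `q(z) = 𝔼[π_{0,1}(0,z)]`. -/
def q {d : ℕ} (P : Measure (Env d)) (z : U d) : ℝ :=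
  ∫ ω, ω 0 0 z ∂P

/-- The limiting velocity `ξ_o = ∑_{z ∈ U} q(z) z`. -/
def limitVelocity {d : ℕ} (P : Measure (Env d)) : EuclideanSpace ℝ (Fin d) :=
  ∑ z : U d, q P z • toReal (z : Fin d → ℤ)

/-- `Λ_c(θ) = log ∑_{z ∈ U} q(z) exp ⟨θ, z⟩`. -/
def logMGF {d : ℕ} (P : Measure (Env d)) (θ : EuclideanSpace ℝ (Fin d)) : ℝ :=
  Real.log (∑ z : U d, q P z * Real.exp (inner ℝ θ (toReal (z : Fin d → ℤ))))

/-- `I_c`, the convex conjugate of `Λ_c`, with values in the extended reals. -/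
def cramerRate {d : ℕ} (P : Measure (Env d)) (ξ : EuclideanSpace ℝ (Fin d)) : EReal :=
  ⨆ θ : EuclideanSpace ℝ (Fin d), ((inner ℝ θ ξ - logMGF P θ : ℝ) : EReal)

/-- The measures `Q n` satisfy the large deviation principle in the open set `O`, with speed `n` and
rate function `I`: the usual definition, for measurable sets contained in `O` and with closures
taken relative to `O`. Here `expGrowthInf u` and `expGrowthSup u` are the `liminf` and `limsup`
of `log (u n) / n`, with `log 0 = -∞`. For `O = univ` this is the usual (full) LDP. -/
structure LDPOn {E : Type*} [TopologicalSpace E] [MeasurableSpace E]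
    (Q : ℕ → Measure E) (I : E → EReal) (O : Set E) : Prop where
  nonneg : ∀ x ∈ O, 0 ≤ I x
  lowerSemicontinuousOn : LowerSemicontinuousOn I O
  lower_bound : ∀ G : Set E, MeasurableSet G → G ⊆ O →
    -(⨅ x ∈ interior G, I x) ≤ ExpGrowth.expGrowthInf fun n => Q n G
  upper_bound : ∀ G : Set E, MeasurableSet G → G ⊆ O →
    ExpGrowth.expGrowthSup (fun n => Q n G) ≤ -(⨅ x ∈ closure G ∩ O, I x)

end SpaceTimeRWRE

end

/-! Write `Z_n(θ)` for the quenched mean of `exp ⟨θ, X_n⟩`. By a local Gärtner–Ellis argument it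
suffices that, almost surely, `log Z_n(θ) / n → Λ_c(θ)` for all `θ` in some ball around `0`.
Dividing every step weight by `mgf P θ` turns `Z_n(θ)` into a partition function `W_n` of mean one
(`integral_partition`), and the task is to show `W_n = exp(o(n))`.

The upper bound is Markov's inequality and Borel–Cantelli (`ae_eventually_partition_le`). The lower
bound rests on second moments. The mean of `W_n(x) W_n(y)` describes two weighted walks in one
environment. Off the diagonal their difference is a centred random walk; on the diagonal the steps
are correlated and the total weight may exceed one. In dimension at least three a bounded function
`1 + potential` is superharmonic for this weighted difference, diagonal included, once `θ` is small
(`exists_superharmonic`). Hence second moments are bounded uniformly in `n` and covariances decay in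
`x - y` (`integral_partition_mul_le`).

No martingale limit is needed. About time `i ^ 7`, average over `i ^ 2` starting points spaced in
multiples of `i ^ 4` at time `i ^ 6`. The variance is `O(i ^ (-2))`, so almost surely, for all large
`i`, one of them has partition function at least `1 / 2` (`ae_eventually_grid`). Ellipticity steers
the walk there at cost `exp(-O(i ^ 6))`, which is subexponential in `n`
(`exp_le_partition_of_grid`).

For velocities near `ξ_o` the supremum defining `I_c` is attained at a small `θ`
(`exists_norm_lt_isMax`), so the limit on a ball of `θ` gives both large deviation bounds there. -/

noncomputable section

/-! ### Quenched expectations as finite recursions. -/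

namespace SpaceTimeRWRE

/-- The expectation of `h` at the position after `n` steps, for the walk started from `x` at
time `k`, computed by first-step analysis. -/
def evolve {d : ℕ} (ω : Env d) (h : (Fin d → ℤ) → ENNReal) : ℕ → ℤ → (Fin d → ℤ) → ENNReal
  | 0, _, x => h x
  | n + 1, k, x => ∑ z : U d, ENNReal.ofReal (ω k x z) * evolve ω h n (k + 1) (x + z)

/-- The partition function of `n` steps from `x` at time `k`, where each step `z` carries the
weight `e z`. -/
def partition {d : ℕ} (ω : Env d) (e : U d → ℝ) : ℕ → ℤ → (Fin d → ℤ) → ℝ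
  | 0, _, _ => 1
  | n + 1, k, x => ∑ z : U d, ω k x z * e z * partition ω e n (k + 1) (x + z)

theorem lintegral_stepMeasure {d : ℕ} (ω : Env d) (n : ℤ) (x : Fin d → ℤ)
    (h : (Fin d → ℤ) → ENNReal) :
    ∫⁻ y, h y ∂stepMeasure ω n x = ∑ z : U d, ENNReal.ofReal (ω n x z) * h (x + z) := by
  simp [stepMeasure, lintegral_finsetSum_measure, lintegral_smul_measure]

/-- The path measure appends steps at the end, while `evolve` peels off the first step; this
identity reconciles the two. -/
theorem evolve_succ_last {d : ℕ} (ω : Env d) (h : (Fin d → ℤ) → ENNReal) (n : ℕ) (k : ℤ)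
    (x : Fin d → ℤ) :
    evolve ω (fun y => ∑ z : U d, ENNReal.ofReal (ω (k + n) y z) * h (y + z)) n k x
      = evolve ω h (n + 1) k x := by
  induction n generalizing k x with
  | zero => simp [evolve]
  | succ n ih =>
    rw [evolve]
    conv_rhs => rw [evolve]
    refine Finset.sum_congr rfl fun z _ => ?_
    rw [← ih]
    congr 3
    push_cast
    ring_nf

theorem lintegral_quenched_succ {d : ℕ} (ω : Env d) (k : ℤ) (x : Fin d → ℤ) (n : ℕ)
    (h : (Fin d → ℤ) → ENNReal) :
    ∫⁻ X, h (X (n + 1)) ∂quenched ω k x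
      = ∫⁻ X, ∑ z : U d, ENNReal.ofReal (ω (k + n) (X n) z) * h (X n + z) ∂quenched ω k x := by
  have hh : Measurable h := measurable_of_countable h
  have key := Kernel.map_frestrictLe_trajMeasure_compProd_eq_map_trajMeasure
    (X := fun _ => Fin d → ℤ) (κ := pathKernel ω k) (μ₀ := Measure.dirac x) (a := n)
  have h1 : ∫⁻ X, h (X (n + 1)) ∂quenched ω k x
      = ∫⁻ p, h p.2 ∂((quenched ω k x).map
          (fun X => (Preorder.frestrictLe (π := fun _ => Fin d → ℤ) n X, X (n + 1)))) := by
    rw [lintegral_map (by fun_prop) (by fun_prop)]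
  rw [h1, quenched, ← key, Measure.lintegral_compProd (by fun_prop),
    lintegral_map (by fun_prop) (by fun_prop)]
  refine lintegral_congr fun X => ?_
  exact lintegral_stepMeasure ω (k + n) (X n) h

/-- Bridge from the Ionescu-Tulcea measure to a recursion. Afterwards the path measure enters only
through `lintegral_velocityLaw_exp`. -/
theorem lintegral_quenched {d : ℕ} (ω : Env d) (k : ℤ) (x : Fin d → ℤ) (n : ℕ)
    (h : (Fin d → ℤ) → ENNReal) :
    ∫⁻ X, h (X n) ∂quenched ω k x = evolve ω h n k x := by
  induction n generalizing h with
  | zero =>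
    have hm0 : Measurable fun Y : Finset.Iic 0 → (Fin d → ℤ) => h (Y ⟨0, by simp⟩) :=
      (measurable_of_countable h).comp (measurable_pi_apply _)
    have key : (quenched ω k x).map
        (Preorder.frestrictLe (π := fun _ => Fin d → ℤ) 0)
        = (Measure.dirac x).map (MeasurableEquiv.piUnique
            (fun _ : Finset.Iic 0 => (Fin d → ℤ))).symm := by
      rw [quenched, Kernel.trajMeasure, Measure.map_comp _ _ (by fun_prop),
        Kernel.traj_map_frestrictLe, Kernel.partialTraj_self, Measure.id_comp]
    have : ∫⁻ X, h (X 0) ∂quenched ω k x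
        = ∫⁻ Y, h (Y ⟨0, by simp⟩) ∂((quenched ω k x).map
          (Preorder.frestrictLe (π := fun _ => Fin d → ℤ) 0)) := by
      rw [lintegral_map hm0 (by fun_prop)]
      rfl
    rw [this, key, lintegral_map hm0 (by fun_prop), lintegral_dirac]
    rfl
  | succ n ih =>
    rw [lintegral_quenched_succ, ← evolve_succ_last]
    exact ih fun y => ∑ z : U d, ENNReal.ofReal (ω (k + n) y z) * h (y + z)

theorem toReal_add {d : ℕ} (x y : Fin d → ℤ) : toReal (x + y) = toReal x + toReal y := by
  ext i
  simp [toReal]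

theorem toReal_zero {d : ℕ} : toReal (0 : Fin d → ℤ) = 0 := by
  ext i
  simp [toReal]

/-- The exponential weights of the steps. -/
def expWeight {d : ℕ} (θ : EuclideanSpace ℝ (Fin d)) (z : U d) : ℝ :=
  Real.exp (inner ℝ θ (toReal (z : Fin d → ℤ)))

/-! ### Partition functions and exponential moments. -/

section Partition

variable {d : ℕ} {ω : Env d} {e e' : U d → ℝ}

theorem partition_nonneg (he : ∀ z, 0 ≤ e z) (n : ℕ) (k : ℤ) (x : Fin d → ℤ) :
    0 ≤ partition ω e n k x := by
  induction n generalizing k x with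
  | zero => simp [partition]
  | succ n ih =>
    exact Finset.sum_nonneg fun z _ =>
      mul_nonneg (mul_nonneg (stdSimplex.zero_le _ _) (he z)) (ih _ _)

theorem partition_smul (c : ℝ) (n : ℕ) (k : ℤ) (x : Fin d → ℤ) :
    partition ω (fun z => c * e z) n k x = c ^ n * partition ω e n k x := by
  induction n generalizing k x with
  | zero => simp [partition]
  | succ n ih =>
    simp only [partition, ih, Finset.mul_sum]
    exact Finset.sum_congr rfl fun z _ => by ring

theorem partition_mono (he : ∀ z, 0 ≤ e z) (h : ∀ z, e z ≤ e' z) (n : ℕ) (k : ℤ)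
    (x : Fin d → ℤ) : partition ω e n k x ≤ partition ω e' n k x := by
  induction n generalizing k x with
  | zero => simp [partition]
  | succ n ih =>
    refine Finset.sum_le_sum fun z _ => ?_
    have h0 : 0 ≤ ω k x z := stdSimplex.zero_le _ _
    exact mul_le_mul (mul_le_mul_of_nonneg_left (h z) h0) (ih _ _)
      (partition_nonneg he _ _ _) (mul_nonneg h0 ((he z).trans (h z)))

theorem partition_const (c : ℝ) (n : ℕ) (k : ℤ) (x : Fin d → ℤ) :
    partition ω (fun _ => c) n k x = c ^ n := by
  induction n generalizing k x with
  | zero => simp [partition]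
  | succ n ih =>
    simp only [partition, ih]
    rw [← Finset.sum_mul, ← Finset.sum_mul, stdSimplex.sum_eq_one, one_mul, pow_succ']

theorem evolve_exp (θ : EuclideanSpace ℝ (Fin d)) (n : ℕ) (k : ℤ) (x : Fin d → ℤ) :
    evolve ω (fun y => ENNReal.ofReal (Real.exp (inner ℝ θ (toReal y)))) n k x
      = ENNReal.ofReal (Real.exp (inner ℝ θ (toReal x)) * partition ω (expWeight θ) n k x) := by
  induction n generalizing k x with
  | zero => simp [evolve, partition]
  | succ n ih =>
    have hw : ∀ z, 0 ≤ expWeight θ z := fun z => (Real.exp_pos _).le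
    simp only [evolve, partition, ih, Finset.mul_sum]
    rw [ENNReal.ofReal_sum_of_nonneg]
    · refine Finset.sum_congr rfl fun z _ => ?_
      rw [← ENNReal.ofReal_mul (stdSimplex.zero_le _ _), toReal_add, inner_add_right,
        Real.exp_add, expWeight]
      congr 1
      ring
    · exact fun z _ => mul_nonneg (Real.exp_pos _).le
        (mul_nonneg (mul_nonneg (stdSimplex.zero_le _ _) (hw z)) (partition_nonneg hw _ _ _))

theorem lintegral_velocityLaw_exp (θ : EuclideanSpace ℝ (Fin d)) {n : ℕ} (hn : n ≠ 0) :
    ∫⁻ y, ENNReal.ofReal (Real.exp (n * inner ℝ θ y)) ∂velocityLaw ω n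
      = ENNReal.ofReal (partition ω (expWeight θ) n 0 0) := by
  rw [velocityLaw, lintegral_map (by fun_prop) (measurable_velocity n)]
  have h := lintegral_quenched ω 0 0 n
    fun y => ENNReal.ofReal (Real.exp (inner ℝ θ (toReal y)))
  rw [evolve_exp, toReal_zero, inner_zero_right, Real.exp_zero, one_mul] at h
  rw [← h]
  refine lintegral_congr fun X => ?_
  rw [inner_smul_right, mul_inv_cancel_left₀ (by exact_mod_cast hn)]

end Partition

/-! ### Scalar drift estimate and whitening. -/

/-- The second Taylor coefficient is `5/32`; the slack in `11/64` absorbs the higher-order terms.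
The exponent `-1/4` makes this polynomial after a fourth power. -/
theorem rpow_neg_quarter_le {u : ℝ} (hu : |u| ≤ 1 / 100) :
    (1 + u) ^ (-(1 / 4) : ℝ) ≤ 1 - u / 4 + 11 / 64 * u ^ 2 := by
  obtain ⟨h1, h2⟩ := abs_le.mp hu
  have hP : 0 < 1 - u / 4 + 11 / 64 * u ^ 2 := by nlinarith [sq_nonneg u]
  have hu0 : 0 < 1 + u := by linarith
  have key : 1 ≤ (1 + u) * (1 - u / 4 + 11 / 64 * u ^ 2) ^ 4 := by
    have hs : 0 ≤ u ^ 2 := sq_nonneg u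
    have h3 : -(u ^ 2 / 100) ≤ u ^ 3 ∧ u ^ 3 ≤ u ^ 2 / 100 := by
      constructor <;> nlinarith
    have h4 : 0 ≤ u ^ 4 := by positivity
    -- Two squarings give `u ^ 2` coefficients `13/32` and `53/50`, rounded down to absorb the
    -- higher powers.
    have hX : 1 - u / 2 + 405 / 1000 * u ^ 2 ≤ (1 - u / 4 + 11 / 64 * u ^ 2) ^ 2 := by
      nlinarith [h3.2]
    have hX0 : 0 ≤ 1 - u / 2 + 405 / 1000 * u ^ 2 := by linarith
    have hY : 1 - u + 105 / 100 * u ^ 2 ≤ (1 - u / 2 + 405 / 1000 * u ^ 2) ^ 2 := by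
      nlinarith [h3.2]
    have hZ : 1 ≤ (1 + u) * (1 - u + 105 / 100 * u ^ 2) := by
      nlinarith [h3.1]
    calc 1 ≤ (1 + u) * (1 - u + 105 / 100 * u ^ 2) := hZ
      _ ≤ (1 + u) * ((1 - u / 4 + 11 / 64 * u ^ 2) ^ 2) ^ 2 :=
        mul_le_mul_of_nonneg_left (hY.trans (pow_le_pow_left₀ hX0 hX 2)) hu0.le
      _ = (1 + u) * (1 - u / 4 + 11 / 64 * u ^ 2) ^ 4 := by ring
  rw [Real.rpow_neg hu0.le, inv_le_comm₀ (Real.rpow_pos_of_pos hu0 _) hP]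
  have : (1 - u / 4 + 11 / 64 * u ^ 2)⁻¹
      = ((1 - u / 4 + 11 / 64 * u ^ 2)⁻¹ ^ (4 : ℕ)) ^ (1 / 4 : ℝ) := by
    rw [← Real.rpow_natCast_mul (inv_nonneg.mpr hP.le)]
    norm_num
  rw [this]
  refine Real.rpow_le_rpow (by positivity) ?_ (by norm_num)
  rw [inv_pow, inv_le_iff_one_le_mul₀ (by positivity)]
  exact key

/-- The scalar form of the drift estimate: `t` is the value of the quadratic form at the current
point, and a step with probability `p i` changes it by `2 * b i + s i`. -/
theorem sum_rpow_neg_quarter_le {ι : Type*} [Fintype ι] {p b s : ι → ℝ} {t R A : ℝ}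
    (hp : ∀ i, 0 ≤ p i) (hp1 : ∑ i, p i = 1) (ht : 0 ≤ t) (hs0 : ∀ i, 0 ≤ s i)
    (hs : ∀ i, s i ≤ R) (hbs : ∀ i, b i ^ 2 ≤ t * s i) (hb0 : ∑ i, p i * b i = 0)
    (hbs0 : ∑ i, p i * (b i * s i) = 0) (hb2 : ∑ i, p i * b i ^ 2 ≤ 51 / 50 * t)
    (hs1 : 147 / 50 ≤ ∑ i, p i * s i) (hA0 : 0 < A) (hA1 : 160000 * R ≤ A) (hA2 : R ^ 2 ≤ A) :
    ∑ i, p i * (t + 2 * b i + s i + A) ^ (-(1 / 4) : ℝ) ≤ (t + A) ^ (-(1 / 4) : ℝ) := by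
  set T := t + A with hT
  have hT0 : 0 < T := by positivity
  set u : ι → ℝ := fun i => (2 * b i + s i) / T with hu
  have hR0 : ∀ i : ι, 0 ≤ R := fun i => (hs0 i).trans (hs i)
  -- From `b² ≤ t s ≤ T R` and `160000 R ≤ A ≤ T`, the term `2 b` is at most `T / 200`; so is `s`.
  have hu1 : ∀ i, |u i| ≤ 1 / 100 := by
    intro i
    rw [hu, abs_div, abs_of_pos hT0, div_le_iff₀ hT0]
    have h1 : |2 * b i| ≤ 1 / 200 * T := by
      refine abs_le_of_sq_le_sq ?_ (by positivity)
      have : b i ^ 2 ≤ T * R := (hbs i).trans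
        (mul_le_mul (by linarith) (hs i) (hs0 i) hT0.le)
      have h2 : 160000 * R ≤ T := by linarith
      nlinarith
    have h2 : |s i| ≤ 1 / 200 * T := by
      rw [abs_of_nonneg (hs0 i)]
      have := hs i
      have := hR0 i
      linarith
    calc |2 * b i + s i| ≤ |2 * b i| + |s i| := abs_add_le _ _
      _ ≤ 1 / 100 * T := by linarith
  have hterm : ∀ i, p i * (t + 2 * b i + s i + A) ^ (-(1 / 4) : ℝ)
      ≤ T ^ (-(1 / 4) : ℝ) * (p i * (1 - u i / 4 + 11 / 64 * u i ^ 2)) := by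
    intro i
    have e : t + 2 * b i + s i + A = T * (1 + u i) := by
      simp only [hu]
      field_simp
      rw [hT]
      ring
    have hpos : 0 ≤ 1 + u i := by linarith [(abs_le.mp (hu1 i)).1]
    rw [e, Real.mul_rpow hT0.le hpos]
    have := mul_le_mul_of_nonneg_left (rpow_neg_quarter_le (hu1 i))
      (mul_nonneg (hp i) (Real.rpow_nonneg hT0.le (-(1 / 4) : ℝ)))
    linarith
  refine (Finset.sum_le_sum fun i _ => hterm i).trans ?_
  rw [← Finset.mul_sum]
  refine mul_le_of_le_one_right (Real.rpow_nonneg hT0.le _) ?_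
  have e1 : ∑ i, p i * u i = (∑ i, p i * s i) / T := by
    have : ∀ i, p i * u i = (2 * (p i * b i) + p i * s i) / T := fun i => by
      simp only [hu]; ring_nf
    simp_rw [this]
    rw [← Finset.sum_div, Finset.sum_add_distrib, ← Finset.mul_sum, hb0]
    ring
  -- Here `102/25 = 4 * 51/50`: the cross term vanishes by `hbs0`, and `s²` is absorbed by `A`
  -- because `R² ≤ A`.
  have e2 : ∑ i, p i * u i ^ 2 ≤ 102 / 25 / T := by
    have : ∀ i, p i * u i ^ 2
        = (4 * (p i * b i ^ 2) + 4 * (p i * (b i * s i)) + p i * s i ^ 2) / T ^ 2 := fun i => by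
      simp only [hu]; ring_nf
    simp_rw [this]
    rw [← Finset.sum_div, Finset.sum_add_distrib, Finset.sum_add_distrib, ← Finset.mul_sum,
      ← Finset.mul_sum, hbs0]
    have h3 : ∑ i, p i * s i ^ 2 ≤ A := by
      calc ∑ i, p i * s i ^ 2 ≤ ∑ i, p i * A := Finset.sum_le_sum fun i _ =>
            mul_le_mul_of_nonneg_left
              ((pow_le_pow_left₀ (hs0 i) (hs i) 2).trans hA2) (hp i)
        _ = A := by rw [← Finset.sum_mul, hp1, one_mul]
    rw [div_le_div_iff₀ (by positivity) hT0]
    have : 4 * ∑ i, p i * b i ^ 2 + 4 * 0 + ∑ i, p i * s i ^ 2 ≤ 102 / 25 * T := by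
      rw [hT]; linarith
    nlinarith
  have e3 : ∑ i, p i * (1 - u i / 4 + 11 / 64 * u i ^ 2)
      = 1 - (∑ i, p i * u i) / 4 + 11 / 64 * ∑ i, p i * u i ^ 2 := by
    calc ∑ i, p i * (1 - u i / 4 + 11 / 64 * u i ^ 2)
        = ∑ i, (p i - p i * u i / 4 + 11 / 64 * (p i * u i ^ 2)) :=
          Finset.sum_congr rfl fun i _ => by ring
      _ = _ := by
        rw [Finset.sum_add_distrib, Finset.sum_sub_distrib, hp1, Finset.mul_sum, Finset.sum_div]
  rw [e3, e1]
  have h4 : 147 / 50 / T ≤ (∑ i, p i * s i) / T := by gcongr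
  -- The gain `147/200 = 0.735` beats the loss `0.70125`. To leading order, exponent `-α` needs `d >
  -- 2(1 + α)`, so `α = 1/4` works from dimension three.
  have h5 : 11 / 64 * (102 / 25 / T) ≤ 147 / 50 / T / 4 := by
    have : 0 < 1 / T := by positivity
    have a1 : 11 / 64 * (102 / 25 / T) = (11 / 64 * (102 / 25)) * (1 / T) := by ring
    have a2 : 147 / 50 / T / 4 = (147 / 200) * (1 / T) := by ring
    rw [a1, a2]
    exact mul_le_mul_of_nonneg_right (by norm_num) this.le
  linarith

open Matrix in
open scoped MatrixOrder ComplexOrder in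
/-- A non-degenerate finite family of weighted vectors can be made isotropic by an invertible
linear map. -/
theorem exists_whitening {ι n : Type*} [Fintype ι] [Fintype n] [DecidableEq n] {p : ι → ℝ}
    {D : ι → n → ℝ}
    (h : ∀ y : n → ℝ, y ≠ 0 → 0 < ∑ i, p i * (y ⬝ᵥ D i) ^ 2) :
    ∃ M : Matrix n n ℝ, IsUnit M ∧
      ∀ y : n → ℝ, ∑ i, p i * (y ⬝ᵥ (M *ᵥ D i)) ^ 2 = y ⬝ᵥ y := by
  set S : Matrix n n ℝ := ∑ i, p i • vecMulVec (D i) (D i) with hS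
  have hquad : ∀ y : n → ℝ, y ⬝ᵥ (S *ᵥ y) = ∑ i, p i * (y ⬝ᵥ D i) ^ 2 := by
    intro y
    rw [hS, Matrix.sum_mulVec, dotProduct_sum]
    refine Finset.sum_congr rfl fun i _ => ?_
    rw [Matrix.smul_mulVec, vecMulVec_mulVec, dotProduct_smul, dotProduct_smul,
      dotProduct_comm (D i) y]
    simp only [smul_eq_mul, MulOpposite.smul_eq_mul_unop, MulOpposite.unop_op]
    ring
  have hpos : S.PosDef := by
    refine Matrix.PosDef.of_dotProduct_mulVec_pos ?_ fun y hy => ?_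
    · rw [Matrix.IsHermitian, hS, Matrix.conjTranspose_sum]
      refine Finset.sum_congr rfl fun i _ => ?_
      ext a b
      simp [vecMulVec_apply, mul_comm]
    · rw [star_trivial, hquad]
      exact h y hy
  -- With `S = Cᵀ C`, the choice `M = (C⁻¹)ᵀ` gives `M S Mᵀ = 1`.
  obtain ⟨C, hC⟩ := CStarAlgebra.nonneg_iff_eq_star_mul_self.mp hpos.posSemidef.nonneg
  have hCu : IsUnit C.det := by
    have := hpos.det_pos
    rw [hC, det_mul] at this
    exact isUnit_iff_ne_zero.mpr (right_ne_zero_of_mul this.ne')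
  refine ⟨(C⁻¹)ᵀ, ?_, fun y => ?_⟩
  · rw [Matrix.isUnit_iff_isUnit_det, det_transpose]
    exact Matrix.isUnit_nonsing_inv_det C hCu
  · have e1 : ∀ i, y ⬝ᵥ ((C⁻¹)ᵀ *ᵥ D i) = (C⁻¹ *ᵥ y) ⬝ᵥ D i := fun i => by
      rw [dotProduct_mulVec, vecMul_transpose]
    simp_rw [e1]
    rw [← hquad, hC, star_eq_conjTranspose, conjTranspose_eq_transpose_of_trivial,
      ← Matrix.mulVec_mulVec, dotProduct_mulVec _ Cᵀ, vecMul_transpose, Matrix.mulVec_mulVec,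
      Matrix.mul_nonsing_inv C hCu, Matrix.one_mulVec]

/-- Exchanging the two walks negates their difference, so odd moments of the difference step vanish.
-/
theorem sum_sum_eq_zero_of_antisymm {ι : Type*} [Fintype ι] {F : ι → ι → ℝ}
    (h : ∀ i j, F j i = -F i j) : ∑ i, ∑ j, F i j = 0 := by
  have h2 : ∑ i, ∑ j, F i j + ∑ i, ∑ j, F j i = 0 := by
    rw [← Finset.sum_add_distrib]
    refine Finset.sum_eq_zero fun i _ => ?_
    rw [← Finset.sum_add_distrib]
    exact Finset.sum_eq_zero fun j _ => by rw [h]; ring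
  rw [Finset.sum_comm (f := fun i j => F j i)] at h2
  linarith

/-! ### A superharmonic function for the difference walk. -/

section Potential

variable {d : ℕ}

/-- The embedding of `ℤ^d` in `ℝ^d` followed by the linear map `M`. -/
def realMulVec (M : Matrix (Fin d) (Fin d) ℝ) (v : Fin d → ℤ) : Fin d → ℝ :=
  M.mulVec fun i => (v i : ℝ)

theorem realMulVec_add (M : Matrix (Fin d) (Fin d) ℝ) (v w : Fin d → ℤ) :
    realMulVec M (v + w) = realMulVec M v + realMulVec M w := by
  rw [realMulVec, realMulVec, realMulVec, ← Matrix.mulVec_add]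
  congr 1
  ext i
  simp

theorem realMulVec_neg (M : Matrix (Fin d) (Fin d) ℝ) (v : Fin d → ℤ) :
    realMulVec M (-v) = -realMulVec M v := by
  rw [realMulVec, realMulVec, ← Matrix.mulVec_neg]
  congr 1
  ext i
  simp

theorem realMulVec_zsmul (M : Matrix (Fin d) (Fin d) ℝ) (l : ℤ) (v : Fin d → ℤ) :
    realMulVec M (l • v) = (l : ℝ) • realMulVec M v := by
  rw [realMulVec, realMulVec, ← Matrix.mulVec_smul]
  congr 1
  ext i
  simp

theorem realMulVec_ne_zero {M : Matrix (Fin d) (Fin d) ℝ} (hM : IsUnit M) {v : Fin d → ℤ}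
    (hv : v ≠ 0) : realMulVec M v ≠ 0 := by
  intro h
  apply hv
  have h0 : (fun i => (v i : ℝ)) = 0 :=
    Matrix.mulVec_injective_iff_isUnit.mpr hM (by rw [Matrix.mulVec_zero]; exact h)
  ext i
  have hi : (v i : ℝ) = 0 := congrFun h0 i
  exact_mod_cast hi

theorem dotProduct_self_nonneg' (y : Fin d → ℝ) : 0 ≤ y ⬝ᵥ y :=
  Finset.sum_nonneg fun i _ => mul_self_nonneg (y i)

/-- The potential `(|M v|² + A) ^ (-1/4)`. -/
def potential (M : Matrix (Fin d) (Fin d) ℝ) (A : ℝ) (v : Fin d → ℤ) : ℝ :=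
  (realMulVec M v ⬝ᵥ realMulVec M v + A) ^ (-(1 / 4) : ℝ)

theorem potential_pos (M : Matrix (Fin d) (Fin d) ℝ) {A : ℝ} (hA : 0 < A) (v : Fin d → ℤ) :
    0 < potential M A v :=
  Real.rpow_pos_of_pos (by linarith [dotProduct_self_nonneg' (realMulVec M v)]) _

theorem realMulVec_zero (M : Matrix (Fin d) (Fin d) ℝ) : realMulVec M 0 = 0 := by
  have := realMulVec_zsmul M 0 0
  simpa using this

theorem potential_le_zero (M : Matrix (Fin d) (Fin d) ℝ) {A : ℝ} (hA : 0 < A)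
    (v : Fin d → ℤ) : potential M A v ≤ potential M A 0 := by
  rw [potential, potential, realMulVec_zero, zero_dotProduct, zero_add]
  exact Real.rpow_le_rpow_of_nonpos hA (by linarith [dotProduct_self_nonneg' (realMulVec M v)])
    (by norm_num)

theorem dotProduct_self_pos' {y : Fin d → ℝ} (hy : y ≠ 0) : 0 < y ⬝ᵥ y :=
  (dotProduct_self_nonneg' y).lt_of_ne' (mt dotProduct_self_eq_zero.mp hy)

theorem potential_lt_zero {M : Matrix (Fin d) (Fin d) ℝ} (hM : IsUnit M) {A : ℝ} (hA : 0 < A)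
    {v : Fin d → ℤ} (hv : v ≠ 0) : potential M A v < potential M A 0 := by
  rw [potential, potential, realMulVec_zero, zero_dotProduct, zero_add]
  exact Real.rpow_lt_rpow_of_neg hA
    (by linarith [dotProduct_self_pos' (realMulVec_ne_zero hM hv)]) (by norm_num)

/-- The potential decays like `|l| ^ (-1/2)`, which is at most `i ^ (-2)`. This spacing makes the
covariances of the grid summable in `i`. -/
theorem potential_zsmul_le {M : Matrix (Fin d) (Fin d) ℝ} (hM : IsUnit M) {A : ℝ} (hA : 0 < A)
    {v : Fin d → ℤ} (hv : v ≠ 0) {i : ℕ} (hi : 0 < i) {l : ℤ} (hl : (i : ℤ) ^ 4 ≤ |l|) :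
    potential M A (l • v)
      ≤ (realMulVec M v ⬝ᵥ realMulVec M v) ^ (-(1 / 4) : ℝ) / (i : ℝ) ^ 2 := by
  set κ := realMulVec M v ⬝ᵥ realMulVec M v with hκ
  have hκ0 : 0 < κ := dotProduct_self_pos' (realMulVec_ne_zero hM hv)
  have hi0 : (0 : ℝ) < i := by exact_mod_cast hi
  have e : ((i : ℝ) ^ 8) ^ (-(1 / 4) : ℝ) = 1 / (i : ℝ) ^ 2 := by
    have e' : 1 / (i : ℝ) ^ 2 = (i : ℝ) ^ (-2 : ℝ) := by
      rw [Real.rpow_neg hi0.le, one_div, Real.rpow_two]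
    rw [← Real.rpow_natCast_mul hi0.le, e']
    norm_num
  have hl' : ((i : ℝ) ^ 8) ≤ (l : ℝ) ^ 2 := by
    have h1 : ((i : ℝ) ^ 4) ≤ |(l : ℝ)| := by exact_mod_cast hl
    calc ((i : ℝ) ^ 8) = (i ^ 4) ^ 2 := by ring
      _ ≤ |(l : ℝ)| ^ 2 := pow_le_pow_left₀ (by positivity) h1 2
      _ = (l : ℝ) ^ 2 := sq_abs _
  rw [potential, realMulVec_zsmul, smul_dotProduct, dotProduct_smul, ← hκ,
    div_eq_mul_one_div (κ ^ (-(1 / 4) : ℝ)), ← e, ← Real.mul_rpow hκ0.le (by positivity)]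
  refine Real.rpow_le_rpow_of_nonpos (by positivity) ?_ (by norm_num)
  simp only [smul_eq_mul]
  nlinarith

theorem dotProduct_sq_le (x y : Fin d → ℝ) : (x ⬝ᵥ y) ^ 2 ≤ (x ⬝ᵥ x) * (y ⬝ᵥ y) := by
  have := Finset.sum_mul_sq_le_sq_mul_sq Finset.univ x y
  simpa only [dotProduct, pow_two] using this

/-- The step `±e_i`. -/
theorem single_mem_U (i : Fin d) {s : ℤ} (hs : |s| = 1) : Pi.single i s ∈ U d := by
  rw [mem_U, Finset.sum_eq_single i]
  · simpa using hs
  · intro j _ hj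
    simp [hj]
  · simp

/-- The steps `e_i` and `-e_i` differ by `2 e_i`, so the difference steps span and their covariance
can be whitened. -/
theorem sum_sq_dotProduct_step_pos {q : U d → ℝ} (hq : ∀ z, 0 < q z) {y : Fin d → ℝ}
    (hy : y ≠ 0) :
    0 < ∑ p : U d × U d, q p.1 * q p.2 *
      (y ⬝ᵥ fun i => (((p.1 : Fin d → ℤ) - (p.2 : Fin d → ℤ)) i : ℝ)) ^ 2 := by
  obtain ⟨i, hi⟩ := Function.ne_iff.mp hy
  let z₀ : U d := ⟨Pi.single i 1, single_mem_U i (by simp)⟩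
  let w₀ : U d := ⟨Pi.single i (-1), single_mem_U i (by simp)⟩
  have hne : (y ⬝ᵥ fun j => (((z₀ : Fin d → ℤ) - (w₀ : Fin d → ℤ)) j : ℝ)) ≠ 0 := by
    have e : (fun j => (((z₀ : Fin d → ℤ) - (w₀ : Fin d → ℤ)) j : ℝ)) = Pi.single i 2 := by
      ext j
      rcases eq_or_ne j i with rfl | hj
      · simp [z₀, w₀]
      · simp [z₀, w₀, hj]
    rw [e, dotProduct_single]
    exact mul_ne_zero hi two_ne_zero
  exact Finset.sum_pos' (fun p _ => mul_nonneg (mul_pos (hq _) (hq _)).le (sq_nonneg _))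
    ⟨(z₀, w₀), Finset.mem_univ _, mul_pos (mul_pos (hq _) (hq _)) (sq_pos_of_ne_zero hne)⟩

/-- After whitening, the untilted difference step has identity covariance: its squared length has
mean `d`. The tilt changes pair probabilities by at most two percent, which leaves mean at least `3
* 49/50 = 147/50`. -/
theorem exists_potential (hd : 3 ≤ d) {q : U d → ℝ} (hq : ∀ z, 0 < q z) :
    ∃ M : Matrix (Fin d) (Fin d) ℝ, IsUnit M ∧ ∃ A : ℝ, 0 < A ∧
      ∀ e : U d → ℝ, (∀ z, 0 ≤ e z) → (∀ z w, 49 / 50 ≤ e z * e w) →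
        (∀ z w, e z * e w ≤ 51 / 50) → ∑ z, q z * e z = 1 → ∀ v : Fin d → ℤ,
        ∑ z : U d, ∑ w : U d, q z * e z * (q w * e w) *
          potential M A (v + ((z : Fin d → ℤ) - (w : Fin d → ℤ))) ≤ potential M A v := by
  obtain ⟨M, hM, hiso⟩ := exists_whitening
    (fun y hy => sum_sq_dotProduct_step_pos hq (y := y) hy)
  set m : U d → U d → Fin d → ℝ :=
    fun z w => realMulVec M ((z : Fin d → ℤ) - (w : Fin d → ℤ)) with hm
  have hiso' : ∀ y : Fin d → ℝ, ∑ z, ∑ w, q z * q w * (y ⬝ᵥ m z w) ^ 2 = y ⬝ᵥ y := fun y => by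
    rw [← hiso y, Fintype.sum_prod_type]
    rfl
  have hanti : ∀ z w, m w z = -m z w := fun z w => by
    simp only [hm]
    rw [← realMulVec_neg, neg_sub]
  have htrace : ∑ z, ∑ w, q z * q w * (m z w ⬝ᵥ m z w) = d := by
    have h1 : ∀ k : Fin d, ∑ z, ∑ w, q z * q w * (m z w k) ^ 2 = 1 := fun k => by
      have := hiso' (Pi.single k 1)
      simpa using this
    calc ∑ z, ∑ w, q z * q w * (m z w ⬝ᵥ m z w)
        = ∑ z, ∑ w, ∑ k, q z * q w * (m z w k) ^ 2 := by
          refine Finset.sum_congr rfl fun z _ => Finset.sum_congr rfl fun w _ => ?_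
          rw [dotProduct, Finset.mul_sum]
          exact Finset.sum_congr rfl fun k _ => by ring
      _ = ∑ k : Fin d, ∑ z, ∑ w, q z * q w * (m z w k) ^ 2 := by
          rw [Finset.sum_comm (s := Finset.univ (α := Fin d))]
          exact Finset.sum_congr rfl fun z _ => Finset.sum_comm
      _ = d := by simp only [h1, Finset.sum_const, Finset.card_univ, Fintype.card_fin,
                    nsmul_eq_mul, mul_one]
  obtain ⟨R, hR⟩ : ∃ R, ∀ p : U d × U d, m p.1 p.2 ⬝ᵥ m p.1 p.2 ≤ R := by
    obtain ⟨R, hR⟩ := (Set.finite_range fun p : U d × U d => m p.1 p.2 ⬝ᵥ m p.1 p.2).bddAbove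
    exact ⟨R, fun p => hR ⟨p, rfl⟩⟩
  refine ⟨M, hM, max 1 (max (160000 * R) (R ^ 2)), by positivity, fun e he0 he1 he2 hqe v => ?_⟩
  set A := max 1 (max (160000 * R) (R ^ 2))
  set y := realMulVec M v with hy
  have hpe : ∀ z w, q z * e z * (q w * e w) = q z * q w * (e z * e w) := fun z w => by ring
  have hqq : ∀ z w, 0 ≤ q z * q w := fun z w => (mul_pos (hq z) (hq w)).le
  have key := sum_rpow_neg_quarter_le (ι := U d × U d)
    (p := fun p => q p.1 * e p.1 * (q p.2 * e p.2)) (b := fun p => y ⬝ᵥ m p.1 p.2)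
    (s := fun p => m p.1 p.2 ⬝ᵥ m p.1 p.2) (t := y ⬝ᵥ y) (R := R) (A := A)
    (fun p => mul_nonneg (mul_nonneg (hq _).le (he0 _)) (mul_nonneg (hq _).le (he0 _)))
    (by
      rw [Fintype.sum_prod_type]
      simp only
      rw [← Fintype.sum_mul_sum (fun z => q z * e z) (fun z => q z * e z), hqe, one_mul])
    (dotProduct_self_nonneg' y) (fun p => dotProduct_self_nonneg' _) hR
    (fun p => dotProduct_sq_le _ _)
    (by
      rw [Fintype.sum_prod_type]
      refine sum_sum_eq_zero_of_antisymm fun z w => ?_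
      simp only
      rw [hanti z w, dotProduct_neg]
      ring)
    (by
      rw [Fintype.sum_prod_type]
      refine sum_sum_eq_zero_of_antisymm fun z w => ?_
      simp only
      rw [hanti z w, dotProduct_neg, dotProduct_neg, neg_dotProduct]
      ring)
    (by
      rw [Fintype.sum_prod_type, ← hiso' y, Finset.mul_sum]
      refine Finset.sum_le_sum fun z _ => ?_
      rw [Finset.mul_sum]
      refine Finset.sum_le_sum fun w _ => ?_
      simp only [hpe]
      have := mul_le_mul_of_nonneg_left (he2 z w)
        (mul_nonneg (hqq z w) (sq_nonneg (y ⬝ᵥ m z w)))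
      linarith)
    (by
      have h3 : (3 : ℝ) ≤ d := by exact_mod_cast hd
      calc (147 / 50 : ℝ) ≤ 49 / 50 * d := by linarith
        _ ≤ _ := by
          rw [Fintype.sum_prod_type, ← htrace, Finset.mul_sum]
          refine Finset.sum_le_sum fun z _ => ?_
          rw [Finset.mul_sum]
          refine Finset.sum_le_sum fun w _ => ?_
          simp only [hpe]
          have := mul_le_mul_of_nonneg_left (he1 z w)
            (mul_nonneg (hqq z w) (dotProduct_self_nonneg' (m z w)))
          linarith)
    (by positivity) (le_max_of_le_right (le_max_left _ _))
    (le_max_of_le_right (le_max_right _ _))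
  rw [Fintype.sum_prod_type] at key
  refine le_trans (le_of_eq ?_) key
  refine Finset.sum_congr rfl fun z _ => Finset.sum_congr rfl fun w _ => ?_
  rw [potential, realMulVec_add]
  simp only [add_dotProduct, dotProduct_add]
  rw [dotProduct_comm (realMulVec M (_ - _)) (realMulVec M v)]
  simp only [hy, hm]
  ring_nf

/-- For weights close to `1`, the function `1 + potential` is superharmonic for the difference of
two weighted walks in the same environment. -/
theorem exists_superharmonic (hd : 3 ≤ d) {q : U d → ℝ} (hq : ∀ z, 0 < q z)
    {m : U d → U d → ℝ} (hm : ∀ z w, 0 < m z w) (hm1 : ∑ z, ∑ w, m z w = 1) :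
    ∃ M : Matrix (Fin d) (Fin d) ℝ, IsUnit M ∧ ∃ A : ℝ, 0 < A ∧
      ∀ᶠ e : U d → ℝ in nhds 1, ∑ z, q z * e z = 1 →
        (∀ v : Fin d → ℤ, ∑ z : U d, ∑ w : U d, q z * e z * (q w * e w) *
          (1 + potential M A (v + ((z : Fin d → ℤ) - (w : Fin d → ℤ))))
            ≤ 1 + potential M A v) ∧
        ∑ z : U d, ∑ w : U d, m z w * (e z * e w) *
          (1 + potential M A ((z : Fin d → ℤ) - (w : Fin d → ℤ))) ≤ 1 + potential M A 0 := by
  obtain ⟨M, hM, A, hA, h⟩ := exists_potential hd hq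
  refine ⟨M, hM, A, hA, ?_⟩
  have h0 : ∀ᶠ e : U d → ℝ in nhds 1, ∀ z, 0 < e z := by
    rw [eventually_all]
    exact fun z => (continuous_apply z).continuousAt.eventually (lt_mem_nhds (by simp))
  have h1 : ∀ᶠ e : U d → ℝ in nhds 1, ∀ z w, 49 / 50 < e z * e w := by
    simp_rw [eventually_all]
    exact fun z w => ((continuous_apply z).mul (continuous_apply w)).continuousAt.eventually
      (lt_mem_nhds (by norm_num))
  have h2 : ∀ᶠ e : U d → ℝ in nhds 1, ∀ z w, e z * e w < 51 / 50 := by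
    simp_rw [eventually_all]
    exact fun z w => ((continuous_apply z).mul (continuous_apply w)).continuousAt.eventually
      (gt_mem_nhds (by norm_num))
  -- On the diagonal both walks read the same site, so their joint step law is `m`, whose tilted
  -- mass may exceed one. At `e = 1` the inequality is strict, since the potential has a strict
  -- maximum at `0` and `m` charges distinct steps; continuity keeps it for nearby `e`.
  have h3 : ∀ᶠ e : U d → ℝ in nhds 1, ∑ z : U d, ∑ w : U d, m z w * (e z * e w) *
      (1 + potential M A ((z : Fin d → ℤ) - (w : Fin d → ℤ))) < 1 + potential M A 0 := by
    have hc : Continuous fun e : U d → ℝ => ∑ z : U d, ∑ w : U d, m z w * (e z * e w) *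
        (1 + potential M A ((z : Fin d → ℤ) - (w : Fin d → ℤ))) := by fun_prop
    refine hc.continuousAt.eventually (gt_mem_nhds ?_)
    simp only [Pi.one_apply, mul_one]
    let i : Fin d := ⟨0, by omega⟩
    let z₀ : U d := ⟨Pi.single i 1, single_mem_U i (by simp)⟩
    let w₀ : U d := ⟨Pi.single i (-1), single_mem_U i (by simp)⟩
    have hne : (z₀ : Fin d → ℤ) - (w₀ : Fin d → ℤ) ≠ 0 := by
      intro hh
      have := congrFun hh i
      simp [z₀, w₀] at this
    calc ∑ z : U d, ∑ w : U d, m z w *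
          (1 + potential M A ((z : Fin d → ℤ) - (w : Fin d → ℤ)))
        < ∑ z : U d, ∑ w : U d, m z w * (1 + potential M A 0) := by
          rw [← Fintype.sum_prod_type', ← Fintype.sum_prod_type']
          refine Finset.sum_lt_sum (fun p _ => mul_le_mul_of_nonneg_left
            (by linarith [potential_le_zero M hA ((p.1 : Fin d → ℤ) - (p.2 : Fin d → ℤ))])
            (hm _ _).le) ⟨(z₀, w₀), Finset.mem_univ _, mul_lt_mul_of_pos_left
            (by linarith [potential_lt_zero hM hA hne]) (hm _ _)⟩
      _ = 1 + potential M A 0 := by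
          simp_rw [← Finset.sum_mul]
          rw [hm1, one_mul]
  filter_upwards [h0, h1, h2, h3] with e he0 he1 he2 he3 hqe
  refine ⟨fun v => ?_, he3.le⟩
  have := h e (fun z => (he0 z).le) (fun z w => (he1 z w).le) (fun z w => (he2 z w).le) hqe v
  simp_rw [mul_add, mul_one, Finset.sum_add_distrib, ← Finset.mul_sum, ← Finset.sum_mul, hqe]
  simp_rw [mul_assoc] at this ⊢
  simpa using this

end Potential

/-! ### First and second moments over the environment. -/

section Moments

variable {d : ℕ}

/-- The σ-algebra generated by the environment at the space-time points of `S`. -/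
abbrev envSigma (S : Set (ℤ × (Fin d → ℤ))) : MeasurableSpace (Env d) :=
  ⨆ p ∈ S, MeasurableSpace.comap (fun ω : Env d => ω p.1 p.2) inferInstance

theorem measurable_siteEnv_apply (z : U d) : Measurable fun a : SiteEnv d => a z :=
  (measurable_pi_apply z).comp measurable_subtype_coe

theorem measurable_env_apply (k : ℤ) (x : Fin d → ℤ) (z : U d) :
    Measurable fun ω : Env d => ω k x z :=
  (measurable_siteEnv_apply z).comp ((measurable_pi_apply x).comp (measurable_pi_apply k))

theorem envSigma_le (S : Set (ℤ × (Fin d → ℤ))) : envSigma S ≤ MeasurableSpace.pi :=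
  iSup₂_le fun p _ => Measurable.comap_le
    ((measurable_pi_apply p.2).comp (measurable_pi_apply p.1))

theorem envSigma_mono {S T : Set (ℤ × (Fin d → ℤ))} (h : S ⊆ T) : envSigma S ≤ envSigma T :=
  biSup_mono h

theorem measurable_env_apply_envSigma {S : Set (ℤ × (Fin d → ℤ))} {k : ℤ} {x : Fin d → ℤ}
    (h : (k, x) ∈ S) (z : U d) : Measurable[envSigma S] fun ω : Env d => ω k x z := by
  have h1 : Measurable[envSigma S] fun ω : Env d => ω k x := by
    rw [measurable_iff_comap_le]
    exact le_iSup₂_of_le (k, x) h le_rfl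
  exact (measurable_siteEnv_apply z).comp h1

theorem measurable_partition_envSigma (e : U d → ℝ) (n : ℕ) (k : ℤ) (x : Fin d → ℤ) :
    Measurable[envSigma {p : ℤ × (Fin d → ℤ) | k ≤ p.1}] fun ω => partition ω e n k x := by
  induction n generalizing k x with
  | zero => exact measurable_const
  | succ n ih =>
    refine Finset.measurable_fun_sum _ fun z _ => ?_
    refine Measurable.mul (Measurable.mul_const ?_ _) ?_
    · exact measurable_env_apply_envSigma (S := {p : ℤ × (Fin d → ℤ) | k ≤ p.1})
        (le_refl k) z
    · refine (ih (k + 1) (x + z)).mono (envSigma_mono fun p hp => ?_) le_rfl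
      exact (by simp : k ≤ k + 1).trans hp

theorem measurable_partition (e : U d → ℝ) (n : ℕ) (k : ℤ) (x : Fin d → ℤ) :
    Measurable fun ω => partition ω e n k x :=
  (measurable_partition_envSigma e n k x).mono (envSigma_le _) le_rfl

theorem env_nonneg (ω : Env d) (k : ℤ) (x : Fin d → ℤ) (z : U d) : 0 ≤ ω k x z :=
  stdSimplex.zero_le _ _

theorem env_le_one (ω : Env d) (k : ℤ) (x : Fin d → ℤ) (z : U d) : ω k x z ≤ 1 := by
  rw [← stdSimplex.sum_eq_one (ω k x)]
  exact Finset.single_le_sum (f := fun z => ω k x z) (fun w _ => env_nonneg ω k x w)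
    (Finset.mem_univ z)

theorem exists_partition_le {e : U d → ℝ} (he : ∀ z, 0 ≤ e z) (n : ℕ) :
    ∃ C : ℝ, ∀ (ω : Env d) (k : ℤ) (x : Fin d → ℤ), partition ω e n k x ≤ C := by
  refine ⟨(∑ z, e z) ^ n, fun ω k x => ?_⟩
  rw [← partition_const (ω := ω) (∑ z, e z) n k x]
  exact partition_mono he (fun z => Finset.single_le_sum (fun w _ => he w) (Finset.mem_univ z))
    n k x

variable {P : Measure (Env d)}

theorem integrable_of_nonneg_of_le [IsFiniteMeasure P] {f : Env d → ℝ} (hf : Measurable f) (h0 : ∀ ω, 0 ≤ f ω)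
    {C : ℝ} (hC : ∀ ω, f ω ≤ C) : Integrable f P :=
  Integrable.of_bound hf.aestronglyMeasurable C
    (Eventually.of_forall fun ω => by rw [Real.norm_of_nonneg (h0 ω)]; exact hC ω)

theorem integrable_partition [IsFiniteMeasure P] {e : U d → ℝ} (he : ∀ z, 0 ≤ e z) (n : ℕ) (k : ℤ)
    (x : Fin d → ℤ) : Integrable (fun ω => partition ω e n k x) P := by
  obtain ⟨C, hC⟩ := exists_partition_le he n
  exact integrable_of_nonneg_of_le (measurable_partition e n k x)
    (fun ω => partition_nonneg he n k x) (fun ω => hC ω k x)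

theorem integrable_partition_mul [IsFiniteMeasure P] {e : U d → ℝ} (he : ∀ z, 0 ≤ e z) (n : ℕ) (k : ℤ)
    (x y : Fin d → ℤ) :
    Integrable (fun ω => partition ω e n k x * partition ω e n k y) P := by
  obtain ⟨C, hC⟩ := exists_partition_le he n
  exact integrable_of_nonneg_of_le
    ((measurable_partition e n k x).mul (measurable_partition e n k y))
    (fun ω => mul_nonneg (partition_nonneg he n k x) (partition_nonneg he n k y))
    (C := C * C) (fun ω => mul_le_mul (hC ω k x) (hC ω k y) (partition_nonneg he n k y)
      ((partition_nonneg he n k x).trans (hC ω k x)))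

theorem integral_mul_of_disjoint
    (hindep : iIndepFun (fun (p : ℤ × (Fin d → ℤ)) (ω : Env d) => ω p.1 p.2) P)
    {S T : Set (ℤ × (Fin d → ℤ))} (hST : Disjoint S T) {f g : Env d → ℝ}
    (hf : Measurable[envSigma S] f) (hg : Measurable[envSigma T] g) :
    ∫ ω, f ω * g ω ∂P = (∫ ω, f ω ∂P) * ∫ ω, g ω ∂P := by
  have h1 : Indep (envSigma S) (envSigma T) P :=
    indep_iSup_of_disjoint (fun p => Measurable.comap_le
      ((measurable_pi_apply p.2).comp (measurable_pi_apply p.1)))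
      (hindep.iIndep) hST
  have h2 : IndepFun f g P := by
    rw [IndepFun_iff_Indep]
    exact indep_of_indep_of_le_left (indep_of_indep_of_le_right h1 hg.comap_le) hf.comap_le
  exact h2.integral_mul_eq_mul_integral (hf.mono (envSigma_le S) le_rfl).aestronglyMeasurable
    (hg.mono (envSigma_le T) le_rfl).aestronglyMeasurable

theorem integral_env_apply
    (hident : ∀ (n : ℤ) (x : Fin d → ℤ),
      IdentDistrib (fun ω : Env d => ω n x) (fun ω => ω 0 0) P P)
    (k : ℤ) (x : Fin d → ℤ) (z : U d) : ∫ ω, ω k x z ∂P = q P z :=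
  ((hident k x).comp (measurable_siteEnv_apply z)).integral_eq

theorem integral_env_apply_mul_self
    (hident : ∀ (n : ℤ) (x : Fin d → ℤ),
      IdentDistrib (fun ω : Env d => ω n x) (fun ω => ω 0 0) P P)
    (k : ℤ) (x : Fin d → ℤ) (z w : U d) :
    ∫ ω, ω k x z * ω k x w ∂P = ∫ ω, ω 0 0 z * ω 0 0 w ∂P :=
  ((hident k x).comp
    ((measurable_siteEnv_apply z).mul (measurable_siteEnv_apply w))).integral_eq

theorem integral_env_apply_mul
    (hindep : iIndepFun (fun (p : ℤ × (Fin d → ℤ)) (ω : Env d) => ω p.1 p.2) P)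
    (hident : ∀ (n : ℤ) (x : Fin d → ℤ),
      IdentDistrib (fun ω : Env d => ω n x) (fun ω => ω 0 0) P P)
    (k : ℤ) {x y : Fin d → ℤ} (hxy : x ≠ y) (z w : U d) :
    ∫ ω, ω k x z * ω k y w ∂P = q P z * q P w := by
  rw [integral_mul_of_disjoint hindep (S := {(k, x)}) (T := {(k, y)}) (by simpa using hxy)
    (measurable_env_apply_envSigma (Set.mem_singleton (k, x)) z)
    (measurable_env_apply_envSigma (Set.mem_singleton (k, y)) w),
    integral_env_apply hident, integral_env_apply hident]

theorem disjoint_slice_future (k : ℤ) :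
    Disjoint {p : ℤ × (Fin d → ℤ) | p.1 = k} {p | k + 1 ≤ p.1} := by
  rw [Set.disjoint_left]
  intro p (hp : p.1 = k) (hp' : k + 1 ≤ p.1)
  omega

theorem integral_partition [IsProbabilityMeasure P]
    (hindep : iIndepFun (fun (p : ℤ × (Fin d → ℤ)) (ω : Env d) => ω p.1 p.2) P)
    (hident : ∀ (n : ℤ) (x : Fin d → ℤ),
      IdentDistrib (fun ω : Env d => ω n x) (fun ω => ω 0 0) P P)
    {e : U d → ℝ} (he : ∀ z, 0 ≤ e z) (hqe : ∑ z, q P z * e z = 1) (n : ℕ) (k : ℤ)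
    (x : Fin d → ℤ) : ∫ ω, partition ω e n k x ∂P = 1 := by
  induction n generalizing k x with
  | zero => simp [partition]
  | succ n ih =>
    have hterm : ∀ z : U d, ∫ ω, ω k x z * e z * partition ω e n (k + 1) (x + z) ∂P
        = q P z * e z := fun z => by
      rw [integral_mul_of_disjoint hindep (disjoint_slice_future k)
        ((measurable_env_apply_envSigma (S := {p : ℤ × (Fin d → ℤ) | p.1 = k}) rfl z).mul_const _)
        (measurable_partition_envSigma e n (k + 1) (x + z)), ih, integral_mul_const,
        integral_env_apply hident, mul_one]
    simp only [partition]
    rw [integral_finsetSum]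
    · simp_rw [hterm]
      exact hqe
    · intro z _
      obtain ⟨C, hC⟩ := exists_partition_le he n
      refine integrable_of_nonneg_of_le
        (((measurable_env_apply k x z).mul_const _).mul (measurable_partition e n _ _))
        (fun ω => mul_nonneg (mul_nonneg (env_nonneg ω k x z) (he z)) (partition_nonneg he _ _ _))
        (C := 1 * e z * C) fun ω => ?_
      exact mul_le_mul (mul_le_mul_of_nonneg_right (env_le_one ω k x z) (he z)) (hC ω _ _)
        (partition_nonneg he _ _ _) (by have := he z; positivity)

/-- The first time slice is independent of the future. Within it, distinct sites are independent and
contribute `q ⊗ q`, while a common site contributes the mixed second moment. Superharmonicity of `g`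
in both cases carries the bound through the induction with no loss in `n`. -/
theorem integral_partition_mul_le [IsProbabilityMeasure P]
    (hindep : iIndepFun (fun (p : ℤ × (Fin d → ℤ)) (ω : Env d) => ω p.1 p.2) P)
    (hident : ∀ (n : ℤ) (x : Fin d → ℤ),
      IdentDistrib (fun ω : Env d => ω n x) (fun ω => ω 0 0) P P)
    {e : U d → ℝ} (he : ∀ z, 0 ≤ e z) {g : (Fin d → ℤ) → ℝ} (hg : ∀ v, 1 ≤ g v)
    (hg1 : ∀ v : Fin d → ℤ, ∑ z : U d, ∑ w : U d, q P z * e z * (q P w * e w) *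
      g (v + ((z : Fin d → ℤ) - (w : Fin d → ℤ))) ≤ g v)
    (hg0 : ∑ z : U d, ∑ w : U d, (∫ ω, ω 0 0 z * ω 0 0 w ∂P) * (e z * e w) *
      g ((z : Fin d → ℤ) - (w : Fin d → ℤ)) ≤ g 0)
    (n : ℕ) (k : ℤ) (x y : Fin d → ℤ) :
    ∫ ω, partition ω e n k x * partition ω e n k y ∂P ≤ g (x - y) := by
  induction n generalizing k x y with
  | zero => simpa [partition] using hg _
  | succ n ih =>
    have hS : ∀ z w : U d, Measurable[envSigma {p : ℤ × (Fin d → ℤ) | p.1 = k}]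
        fun ω : Env d => ω k x z * ω k y w * (e z * e w) := fun z w =>
      ((measurable_env_apply_envSigma (S := {p : ℤ × (Fin d → ℤ) | p.1 = k}) rfl z).mul
        (measurable_env_apply_envSigma (S := {p : ℤ × (Fin d → ℤ) | p.1 = k}) rfl w)).mul_const _
    have hT : ∀ z w : U d, Measurable[envSigma {p : ℤ × (Fin d → ℤ) | k + 1 ≤ p.1}]
        fun ω : Env d => partition ω e n (k + 1) (x + z) * partition ω e n (k + 1) (y + w) :=
      fun z w => (measurable_partition_envSigma e n (k + 1) (x + z)).mul
        (measurable_partition_envSigma e n (k + 1) (y + w))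
    have hbound : ∀ z w : U d, 0 ≤ ∫ ω, ω k x z * ω k y w ∂P := fun z w =>
      integral_nonneg fun ω => mul_nonneg (env_nonneg _ _ _ _) (env_nonneg _ _ _ _)
    have hterm : ∀ z w : U d, ∫ ω, ω k x z * ω k y w * (e z * e w) *
        (partition ω e n (k + 1) (x + z) * partition ω e n (k + 1) (y + w)) ∂P
        ≤ (∫ ω, ω k x z * ω k y w ∂P) * (e z * e w) *
          g (x - y + ((z : Fin d → ℤ) - (w : Fin d → ℤ))) := fun z w => by
      rw [integral_mul_of_disjoint hindep (disjoint_slice_future k) (hS z w) (hT z w),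
        integral_mul_const]
      refine mul_le_mul_of_nonneg_left ?_
        (mul_nonneg (hbound z w) (mul_nonneg (he z) (he w)))
      have := ih (k + 1) (x + z) (y + w)
      rwa [add_sub_add_comm] at this
    have hint : ∀ z w : U d, Integrable (fun ω : Env d => ω k x z * ω k y w * (e z * e w) *
        (partition ω e n (k + 1) (x + z) * partition ω e n (k + 1) (y + w))) P := fun z w => by
      obtain ⟨C, hC⟩ := exists_partition_le he n
      have hp := fun (ω : Env d) k x => partition_nonneg (ω := ω) he n k x
      have hee := mul_nonneg (he z) (he w)
      refine integrable_of_nonneg_of_le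
        (((hS z w).mono (envSigma_le _) le_rfl).mul ((hT z w).mono (envSigma_le _) le_rfl))
        (fun ω => mul_nonneg (mul_nonneg (mul_nonneg (env_nonneg _ _ _ _) (env_nonneg _ _ _ _))
          hee) (mul_nonneg (hp _ _ _) (hp _ _ _)))
        (C := 1 * 1 * (e z * e w) * (C * C)) fun ω => ?_
      gcongr
      · exact mul_nonneg (hp _ _ _) (hp _ _ _)
      · exact env_nonneg _ _ _ _
      · exact env_le_one _ _ _ _
      · exact env_le_one _ _ _ _
      · exact hp _ _ _
      · exact (hp ω k x).trans (hC ω k x)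
      · exact hC _ _ _
      · exact hC _ _ _
    have hexp : ∀ ω : Env d, partition ω e (n + 1) k x * partition ω e (n + 1) k y
        = ∑ z : U d, ∑ w : U d, ω k x z * ω k y w * (e z * e w) *
          (partition ω e n (k + 1) (x + z) * partition ω e n (k + 1) (y + w)) := fun ω => by
      simp only [partition]
      rw [Finset.sum_mul_sum]
      exact Finset.sum_congr rfl fun z _ => Finset.sum_congr rfl fun w _ => by ring
    simp_rw [hexp]
    rw [integral_finsetSum _ fun z _ => integrable_finsetSum _ fun w _ => hint z w]
    simp_rw [integral_finsetSum _ fun w _ => hint _ w]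
    refine (Finset.sum_le_sum fun z _ => Finset.sum_le_sum fun w _ => hterm z w).trans ?_
    rcases eq_or_ne x y with rfl | hxy
    · simp_rw [integral_env_apply_mul_self hident, sub_self, zero_add]
      exact hg0
    · simp_rw [integral_env_apply_mul hindep hident k hxy]
      refine le_trans (le_of_eq ?_) (hg1 (x - y))
      exact Finset.sum_congr rfl fun z _ => Finset.sum_congr rfl fun w _ => by ring

end Moments

/-! ### Subexponential growth of the normalised partition function. -/

section Growth

variable {d : ℕ} {ω : Env d} {e : U d → ℝ} {a : ℝ}

theorem mul_partition_le (ha0 : 0 ≤ a) (he : ∀ z, 0 ≤ e z)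
    (ha : ∀ k x z, a ≤ ω k x z * e z) (n : ℕ) (k : ℤ) (x : Fin d → ℤ) (z : U d) :
    a * partition ω e n (k + 1) (x + z) ≤ partition ω e (n + 1) k x := by
  calc a * partition ω e n (k + 1) (x + z)
      ≤ ω k x z * e z * partition ω e n (k + 1) (x + z) :=
        mul_le_mul_of_nonneg_right (ha k x z) (partition_nonneg he _ _ _)
    _ ≤ _ := Finset.single_le_sum
        (f := fun z : U d => ω k x z * e z * partition ω e n (k + 1) (x + z))
        (fun w _ => mul_nonneg (ha0.trans (ha k x w)) (partition_nonneg he _ _ _))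
        (Finset.mem_univ z)

theorem pow_mul_partition_zsmul_le (ha0 : 0 ≤ a) (he : ∀ z, 0 ≤ e z)
    (ha : ∀ k x z, a ≤ ω k x z * e z) (n j : ℕ) (k : ℤ) (x : Fin d → ℤ) (z : U d) :
    a ^ j * partition ω e n (k + j) (x + (j : ℤ) • (z : Fin d → ℤ))
      ≤ partition ω e (n + j) k x := by
  induction j generalizing k x with
  | zero => simp
  | succ j ih =>
    refine le_trans ?_ (mul_partition_le ha0 he ha (n + j) k x z)
    have := mul_le_mul_of_nonneg_left (ih (k + 1) (x + z)) ha0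
    refine le_trans (le_of_eq ?_) this
    rw [pow_succ', mul_assoc]
    congr 3
    · push_cast; ring
    · push_cast; rw [add_smul, one_smul]; abel

theorem pow_mul_partition_le (ha0 : 0 ≤ a) (he : ∀ z, 0 ≤ e z)
    (ha : ∀ k x z, a ≤ ω k x z * e z) (z : U d) (n r : ℕ) (k : ℤ) (x : Fin d → ℤ) :
    a ^ r * partition ω e n k x ≤ partition ω e (n + r) k x := by
  induction n generalizing k x with
  | zero =>
    have := pow_mul_partition_zsmul_le ha0 he ha 0 r k x z
    simpa [partition] using this
  | succ n ih =>
    rw [Nat.add_right_comm]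
    simp only [partition]
    rw [Finset.mul_sum]
    refine Finset.sum_le_sum fun w _ => ?_
    have := mul_le_mul_of_nonneg_left (ih (k + 1) (x + w)) (ha0.trans (ha k x w))
    linarith

/-- Each of the `m` steering steps before, and of the `r` surplus steps after, costs at most a
factor `a`. -/
theorem pow_mul_partition_reachable_le (ha0 : 0 ≤ a) (he : ∀ z, 0 ≤ e z)
    (ha : ∀ k x z, a ≤ ω k x z * e z) (z w : U d) (n r j m : ℕ) (hj : j ≤ m) :
    a ^ (m + r) * partition ω e n m ((j : ℤ) • (z : Fin d → ℤ) + ((m : ℤ) - j) • (w : Fin d → ℤ))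
      ≤ partition ω e (n + r + m) 0 0 := by
  obtain ⟨l, rfl⟩ := Nat.exists_eq_add_of_le hj
  have h1 := pow_mul_partition_zsmul_le ha0 he ha (n + r + l) j 0 0 z
  have h2 := pow_mul_partition_zsmul_le ha0 he ha (n + r) l (0 + j) (0 + (j : ℤ) • (z : Fin d → ℤ)) w
  have h3 := pow_mul_partition_le ha0 he ha z n r (0 + j + l)
    (0 + (j : ℤ) • (z : Fin d → ℤ) + (l : ℤ) • (w : Fin d → ℤ))
  have e1 : ((j + l : ℕ) : ℤ) = 0 + j + l := by push_cast; ring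
  have e2 : (0 + (j : ℤ) • (z : Fin d → ℤ) + (l : ℤ) • (w : Fin d → ℤ))
      = (j : ℤ) • (z : Fin d → ℤ) + (((j + l : ℕ) : ℤ) - j) • (w : Fin d → ℤ) := by
    push_cast; rw [add_sub_cancel_left, zero_add]
  rw [e2, ← e1] at h3
  rw [e2, ← e1] at h2
  rw [show n + r + (j + l) = n + r + l + j by ring]
  have h4 := mul_le_mul_of_nonneg_left
    ((mul_le_mul_of_nonneg_left h3 (pow_nonneg ha0 l)).trans h2) (pow_nonneg ha0 j)
  refine le_trans (le_of_eq ?_) (h4.trans h1)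
  rw [pow_add, pow_add, mul_assoc, mul_assoc]

theorem exists_pow_seven_le_lt (I n : ℕ) (h : I ^ 7 ≤ n) : ∃ i, I ≤ i ∧ i ^ 7 ≤ n ∧ n < (i + 1) ^ 7 := by
  have hex : ∃ m, n < m ^ 7 := ⟨n + 1, by
    calc n < n + 1 := n.lt_succ_self
      _ ≤ (n + 1) ^ 7 := Nat.le_self_pow (by norm_num) _⟩
  classical
  have hI : I < Nat.find hex := by
    by_contra! hc
    exact absurd (Nat.find_spec hex) (not_lt.mpr ((Nat.pow_le_pow_left hc 7).trans h))
  obtain ⟨i, hi⟩ := Nat.exists_eq_succ_of_ne_zero (Nat.ne_of_gt (Nat.zero_lt_of_lt hI))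
  refine ⟨i, by omega, ?_, ?_⟩
  · exact not_lt.mp (Nat.find_min hex (by omega))
  · have := Nat.find_spec hex
    rwa [hi] at this

/-- The starting points, at time `i ^ 6`, over which partition functions are averaged. -/
def gridPoint (z w : U d) (i j : ℕ) : Fin d → ℤ :=
  ((j * i ^ 4 : ℕ) : ℤ) • (z : Fin d → ℤ) + (((i ^ 6 : ℕ) : ℤ) - (j * i ^ 4 : ℕ)) • (w : Fin d → ℤ)

/-- For `i ^ 7 ≤ n < (i + 1) ^ 7`, the steering time `i ^ 6` and the leftover `n - i ^ 7` are both
`O(i ^ 6) = o(n)`, so ellipticity costs only a subexponential factor. -/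
theorem exp_le_partition_of_grid (ha0 : 0 < a) (ha1 : a ≤ 1) (he : ∀ z, 0 ≤ e z)
    (ha : ∀ k x z, a ≤ ω k x z * e z) (z w : U d)
    (h : ∀ᶠ i : ℕ in atTop, ∃ j < i ^ 2,
      1 / 2 ≤ partition ω e (i ^ 7 - i ^ 6) (i ^ 6 : ℕ) (gridPoint z w i j))
    {ε : ℝ} (hε : 0 < ε) : ∀ᶠ n : ℕ in atTop, Real.exp (-(ε * n)) ≤ partition ω e n 0 0 := by
  obtain ⟨α, hα0, hα⟩ : ∃ α, 0 ≤ α ∧ a = Real.exp (-α) :=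
    ⟨-Real.log a, by have := Real.log_nonpos ha0.le ha1; linarith,
      by rw [neg_neg, Real.exp_log ha0]⟩
  obtain ⟨I, hI⟩ := eventually_atTop.mp h
  obtain ⟨K, hK⟩ := exists_nat_ge ((128 * α + 1) / ε)
  filter_upwards [eventually_ge_atTop ((max (max I K) 1) ^ 7)] with n hn
  obtain ⟨i, hi, hin, hni⟩ := exists_pow_seven_le_lt _ n hn
  have hi1 : 1 ≤ i := (le_max_right _ _).trans hi
  have hiI : I ≤ i := ((le_max_left _ _).trans (le_max_left _ _)).trans hi
  have hiK : K ≤ i := ((le_max_right _ _).trans (le_max_left _ _)).trans hi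
  obtain ⟨j, hj, hV⟩ := hI i hiI
  have hjm : j * i ^ 4 ≤ i ^ 6 := by
    calc j * i ^ 4 ≤ i ^ 2 * i ^ 4 := Nat.mul_le_mul_right _ hj.le
      _ = i ^ 6 := by ring
  have h67 : i ^ 6 ≤ i ^ 7 := Nat.pow_le_pow_right hi1 (by norm_num)
  have key := pow_mul_partition_reachable_le ha0.le he ha z w (i ^ 7 - i ^ 6) (n - i ^ 7)
    (j * i ^ 4) (i ^ 6) hjm
  rw [show i ^ 7 - i ^ 6 + (n - i ^ 7) + i ^ 6 = n by omega] at key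
  refine le_trans ?_ key
  -- The lower binomial coefficients of `(i + 1) ^ 7` sum to `2 ^ 7 - 1 = 127`; steering adds one
  -- more `i ^ 6`.
  have hexp : i ^ 6 + (n - i ^ 7) ≤ 128 * i ^ 6 := by
    have h1 : (i + 1) ^ 7 ≤ i ^ 7 + 127 * i ^ 6 := by
      have e5 : i ^ 5 ≤ i ^ 6 := Nat.pow_le_pow_right hi1 (by norm_num)
      have e4 : i ^ 4 ≤ i ^ 6 := Nat.pow_le_pow_right hi1 (by norm_num)
      have e3 : i ^ 3 ≤ i ^ 6 := Nat.pow_le_pow_right hi1 (by norm_num)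
      have e2 : i ^ 2 ≤ i ^ 6 := Nat.pow_le_pow_right hi1 (by norm_num)
      have e1 : i ^ 1 ≤ i ^ 6 := Nat.pow_le_pow_right hi1 (by norm_num)
      have e0 : i ^ 0 ≤ i ^ 6 := Nat.pow_le_pow_right hi1 (by norm_num)
      nlinarith
    omega
  have hpow : Real.exp (-(128 * α * (i : ℝ) ^ 6)) ≤ a ^ (i ^ 6 + (n - i ^ 7)) := by
    calc Real.exp (-(128 * α * (i : ℝ) ^ 6)) = a ^ (128 * i ^ 6) := by
          rw [hα, ← Real.exp_nat_mul]
          congr 1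
          push_cast
          ring
      _ ≤ _ := pow_le_pow_of_le_one ha0.le ha1 hexp
  have hhalf : Real.exp (-1) ≤ 1 / 2 := by
    rw [Real.exp_neg, one_div]
    refine inv_anti₀ two_pos ?_
    have := Real.add_one_le_exp (1 : ℝ)
    linarith
  calc Real.exp (-(ε * n)) ≤ Real.exp (-(128 * α * (i : ℝ) ^ 6)) * Real.exp (-1) := by
        rw [← Real.exp_add, Real.exp_le_exp]
        have hi6 : (1 : ℝ) ≤ (i : ℝ) ^ 6 := one_le_pow₀ (by exact_mod_cast hi1)
        have hK' : 128 * α + 1 ≤ ε * i := by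
          have h1 : (128 * α + 1) / ε ≤ i := hK.trans (by exact_mod_cast hiK)
          rw [div_le_iff₀ hε] at h1
          linarith
        have hn7 : (i : ℝ) * (i : ℝ) ^ 6 ≤ n := by
          have : ((i ^ 7 : ℕ) : ℝ) ≤ n := by exact_mod_cast hin
          push_cast at this
          linarith [pow_succ' (i : ℝ) 6]
        have h2 := mul_le_mul_of_nonneg_right hK' (zero_le_one.trans hi6)
        have h3 := mul_le_mul_of_nonneg_left hn7 hε.le
        nlinarith
    _ ≤ _ := mul_le_mul hpow (hhalf.trans hV) (Real.exp_pos _).le (by positivity)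

variable {P : Measure (Env d)} [IsProbabilityMeasure P]

/-- Chebyshev for the sum of `J` centred variables: if all values are below `1 / 2`, the sum is at
most `-J / 2`, while its variance is at most `J C + J² D`. -/
theorem measureReal_all_lt_half_le (he : ∀ z, 0 ≤ e z)
    {n : ℕ} {k : ℤ} {J : ℕ} (hJ : 0 < J) {x : ℕ → Fin d → ℤ} {C D : ℝ} (hD : 0 ≤ D)
    (hmean : ∀ j, ∫ ω, partition ω e n k (x j) ∂P = 1)
    (hdiag : ∀ j, ∫ ω, partition ω e n k (x j) * partition ω e n k (x j) ∂P ≤ 1 + C)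
    (hoff : ∀ i j, i ≠ j →
      ∫ ω, partition ω e n k (x i) * partition ω e n k (x j) ∂P ≤ 1 + D) :
    P.real {ω | ∀ j < J, partition ω e n k (x j) < 1 / 2} ≤ 4 * (C / J + D) := by
  set V : ℕ → Env d → ℝ := fun j ω => partition ω e n k (x j) with hV
  have hVi : ∀ j, Integrable (V j) P := fun j => integrable_partition he n k (x j)
  have hVV : ∀ i j, Integrable (fun ω => V i ω * V j ω) P := fun i j =>
    integrable_partition_mul he n k (x i) (x j)
  have hterm : ∀ i j, Integrable (fun ω => (V i ω - 1) * (V j ω - 1)) P := fun i j => by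
    have : (fun ω => (V i ω - 1) * (V j ω - 1))
        = fun ω => V i ω * V j ω - V i ω - V j ω + 1 := by ext ω; ring
    rw [this]
    exact (((hVV i j).sub (hVi i)).sub (hVi j)).add (integrable_const 1)
  have hcov : ∀ i j, ∫ ω, (V i ω - 1) * (V j ω - 1) ∂P = ∫ ω, V i ω * V j ω ∂P - 1 :=
    fun i j => by
    have : (fun ω => (V i ω - 1) * (V j ω - 1))
        = fun ω => V i ω * V j ω - V i ω - V j ω + 1 := by ext ω; ring
    have h1 := integral_add (((hVV i j).sub (hVi i)).sub (hVi j)) (integrable_const (1 : ℝ))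
    have h2 := integral_sub ((hVV i j).sub (hVi i)) (hVi j)
    have h3 := integral_sub (hVV i j) (hVi i)
    have h4 : ∫ _, (1 : ℝ) ∂P = 1 := by simp
    simp only [Pi.sub_apply] at h1 h2 h3
    rw [this, h1, h2, h3, h4, show ∫ ω, V i ω ∂P = 1 from hmean i,
      show ∫ ω, V j ω ∂P = 1 from hmean j]
    ring
  have hsq : ∀ ω, (∑ j ∈ Finset.range J, (V j ω - 1)) ^ 2
      = ∑ i ∈ Finset.range J, ∑ j ∈ Finset.range J, (V i ω - 1) * (V j ω - 1) := fun ω => by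
    rw [pow_two, Finset.sum_mul_sum]
  have hsqi : Integrable (fun ω => (∑ j ∈ Finset.range J, (V j ω - 1)) ^ 2) P := by
    simp_rw [hsq]
    exact integrable_finsetSum _ fun i _ => integrable_finsetSum _ fun j _ => hterm i j
  have hvar : ∫ ω, (∑ j ∈ Finset.range J, (V j ω - 1)) ^ 2 ∂P ≤ J * C + J ^ 2 * D := by
    simp_rw [hsq]
    rw [integral_finsetSum _ fun i _ => integrable_finsetSum _ fun j _ => hterm i j]
    simp_rw [integral_finsetSum _ fun j _ => hterm _ j, hcov]
    calc ∑ i ∈ Finset.range J, ∑ j ∈ Finset.range J, (∫ ω, V i ω * V j ω ∂P - 1)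
        ≤ ∑ i ∈ Finset.range J, ∑ j ∈ Finset.range J, ((if i = j then C else 0) + D) := by
          refine Finset.sum_le_sum fun i _ => Finset.sum_le_sum fun j _ => ?_
          split_ifs with hij
          · subst hij
            linarith [hdiag i]
          · linarith [hoff i j hij]
      _ = J * C + J ^ 2 * D := by
          simp_rw [Finset.sum_add_distrib, Finset.sum_ite_eq]
          rw [Finset.sum_congr rfl fun i hi => if_pos hi]
          simp
          ring
  have hJ0 : (0 : ℝ) < J := by exact_mod_cast hJ
  have hmarkov := mul_meas_ge_le_integral_of_nonneg
    (Eventually.of_forall fun ω => sq_nonneg (∑ j ∈ Finset.range J, (V j ω - 1))) hsqi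
    ((J : ℝ) ^ 2 / 4)
  have hsub : P.real {ω | ∀ j < J, partition ω e n k (x j) < 1 / 2}
      ≤ P.real {ω | (J : ℝ) ^ 2 / 4 ≤ (∑ j ∈ Finset.range J, (V j ω - 1)) ^ 2} := by
    refine measureReal_mono fun ω hω => ?_
    have h1 : ∑ j ∈ Finset.range J, (V j ω - 1) ≤ ∑ j ∈ Finset.range J, (-(1 / 2) : ℝ) :=
      Finset.sum_le_sum fun j hj => by
        have : V j ω < 1 / 2 := hω j (Finset.mem_range.mp hj)
        linarith
    rw [Finset.sum_const, Finset.card_range, nsmul_eq_mul] at h1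
    change (J : ℝ) ^ 2 / 4 ≤ _
    nlinarith
  have hfin := (mul_le_mul_of_nonneg_left hsub (by positivity : (0 : ℝ) ≤ (J : ℝ) ^ 2 / 4)).trans
    (hmarkov.trans hvar)
  have : (J : ℝ) ^ 2 / 4 * (4 * (C / J + D)) = J * C + J ^ 2 * D := by
    field_simp
  rw [← this] at hfin
  exact le_of_mul_le_mul_left hfin (by positivity)

theorem ae_eventually_grid
    (hindep : iIndepFun (fun (p : ℤ × (Fin d → ℤ)) (ω : Env d) => ω p.1 p.2) P)
    (hident : ∀ (n : ℤ) (x : Fin d → ℤ),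
      IdentDistrib (fun ω : Env d => ω n x) (fun ω => ω 0 0) P P)
    (he : ∀ z, 0 ≤ e z) (hqe : ∑ z, q P z * e z = 1)
    {M : Matrix (Fin d) (Fin d) ℝ} (hM : IsUnit M) {A : ℝ} (hA : 0 < A)
    (hg1 : ∀ v : Fin d → ℤ, ∑ z : U d, ∑ w : U d, q P z * e z * (q P w * e w) *
      (1 + potential M A (v + ((z : Fin d → ℤ) - (w : Fin d → ℤ)))) ≤ 1 + potential M A v)
    (hg0 : ∑ z : U d, ∑ w : U d, (∫ ω, ω 0 0 z * ω 0 0 w ∂P) * (e z * e w) *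
      (1 + potential M A ((z : Fin d → ℤ) - (w : Fin d → ℤ))) ≤ 1 + potential M A 0)
    {z w : U d} (hzw : z ≠ w) :
    ∀ᵐ ω ∂P, ∀ᶠ i : ℕ in atTop, ∃ j < i ^ 2,
      1 / 2 ≤ partition ω e (i ^ 7 - i ^ 6) (i ^ 6 : ℕ) (gridPoint z w i j) := by
  have hzw' : (z : Fin d → ℤ) - (w : Fin d → ℤ) ≠ 0 :=
    sub_ne_zero.mpr fun h => hzw (Subtype.ext h)
  set κ := (realMulVec M ((z : Fin d → ℤ) - (w : Fin d → ℤ)) ⬝ᵥ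
    realMulVec M ((z : Fin d → ℤ) - (w : Fin d → ℤ))) ^ (-(1 / 4) : ℝ) with hκ
  have hκ0 : 0 ≤ κ := Real.rpow_nonneg (dotProduct_self_nonneg' _) _
  -- At `i = 0` the condition on `j` is vacuous, while the bound below reads `1 / 0 ^ 2 = 0`; the
  -- clause `0 < i` empties the set there.
  set s : ℕ → Set (Env d) := fun i => {ω | 0 < i ∧ ∀ j < i ^ 2,
    partition ω e (i ^ 7 - i ^ 6) (i ^ 6 : ℕ) (gridPoint z w i j) < 1 / 2} with hs
  have hsecond := integral_partition_mul_le hindep hident he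
    (g := fun v => 1 + potential M A v) (fun v => by linarith [potential_pos M hA v]) hg1 hg0
  have hbound : ∀ i, P.real (s i) ≤ 4 * (potential M A 0 + κ) * (1 / (i : ℝ) ^ 2) := by
    intro i
    rcases Nat.eq_zero_or_pos i with rfl | hi
    · simp [hs]
    · have hi0 : (0 : ℝ) < i := by exact_mod_cast hi
      have hdiff : ∀ j j', gridPoint z w i j - gridPoint z w i j'
          = (((j : ℤ) - j') * (i : ℤ) ^ 4) • ((z : Fin d → ℤ) - (w : Fin d → ℤ)) := by
        intro j j'
        ext l
        simp only [gridPoint, Pi.sub_apply, Pi.add_apply, Pi.smul_apply, smul_eq_mul]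
        push_cast
        ring
      -- With `J = i ^ 2` points, the diagonal part `C / J` and the off-diagonal part `D` are both
      -- of order `i ^ (-2)`.
      have := measureReal_all_lt_half_le (P := P) he (n := i ^ 7 - i ^ 6) (k := (i ^ 6 : ℕ))
        (J := i ^ 2) (pow_pos hi 2) (x := gridPoint z w i) (C := potential M A 0)
        (D := κ / (i : ℝ) ^ 2) (by positivity)
        (fun j => integral_partition hindep hident he hqe _ _ _)
        (fun j => by simpa using hsecond _ _ (gridPoint z w i j) (gridPoint z w i j))
        (fun j j' hjj => by
          refine (hsecond _ _ _ _).trans ?_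
          rw [hdiff]
          gcongr
          refine potential_zsmul_le hM hA hzw' hi ?_
          rw [abs_mul, abs_of_nonneg (by positivity : (0 : ℤ) ≤ (i : ℤ) ^ 4)]
          refine le_mul_of_one_le_left (by positivity) ?_
          exact Int.one_le_abs (sub_ne_zero.mpr (by exact_mod_cast hjj)))
      refine (measureReal_mono fun ω hω => hω.2).trans (this.trans (le_of_eq ?_))
      push_cast
      ring
  have hsum : ∑' i, P (s i) ≠ ⊤ := by
    have h1 : Summable fun i : ℕ => 4 * (potential M A 0 + κ) * (1 / (i : ℝ) ^ 2) :=
      (Real.summable_one_div_nat_pow.mpr (by norm_num)).mul_left _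
    refine ne_top_of_le_ne_top h1.tsum_ofReal_ne_top (ENNReal.tsum_le_tsum fun i => ?_)
    rw [← ofReal_measureReal]
    exact ENNReal.ofReal_le_ofReal (hbound i)
  filter_upwards [ae_eventually_notMem hsum] with ω hω
  filter_upwards [hω, eventually_gt_atTop 0] with i hi hi0
  simp only [hs, Set.mem_ofPred_eq, not_and, not_forall, not_lt] at hi
  obtain ⟨j, hj, h⟩ := hi hi0
  exact ⟨j, hj, h⟩

theorem ae_eventually_partition_le
    (hindep : iIndepFun (fun (p : ℤ × (Fin d → ℤ)) (ω : Env d) => ω p.1 p.2) P)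
    (hident : ∀ (n : ℤ) (x : Fin d → ℤ),
      IdentDistrib (fun ω : Env d => ω n x) (fun ω => ω 0 0) P P)
    (he : ∀ z, 0 ≤ e z) (hqe : ∑ z, q P z * e z = 1) :
    ∀ᵐ ω ∂P, ∀ ε : ℝ, 0 < ε → ∀ᶠ n : ℕ in atTop, partition ω e n 0 0 ≤ Real.exp (ε * n) := by
  have hfix : ∀ ε : ℝ, 0 < ε →
      ∀ᵐ ω ∂P, ∀ᶠ n : ℕ in atTop, partition ω e n 0 0 ≤ Real.exp (ε * n) := by
    intro ε hε
    set s : ℕ → Set (Env d) := fun n => {ω | Real.exp (ε * n) ≤ partition ω e n 0 0} with hs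
    have hbound : ∀ n, P.real (s n) ≤ Real.exp (-ε) ^ n := by
      intro n
      have := mul_meas_ge_le_integral_of_nonneg
        (Eventually.of_forall fun ω => partition_nonneg (ω := ω) he n 0 0)
        (integrable_partition (P := P) he n 0 0) (Real.exp (ε * n))
      rw [integral_partition hindep hident he hqe] at this
      rw [← Real.exp_nat_mul, show (n : ℝ) * -ε = -(ε * n) by ring, Real.exp_neg, ← one_div,
        le_div_iff₀ (Real.exp_pos _), mul_comm]
      exact this
    have hsum : ∑' n, P (s n) ≠ ⊤ := by
      have h1 : Summable fun n : ℕ => Real.exp (-ε) ^ n :=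
        summable_geometric_of_lt_one (Real.exp_pos _).le (Real.exp_lt_one_iff.mpr (by linarith))
      refine ne_top_of_le_ne_top h1.tsum_ofReal_ne_top (ENNReal.tsum_le_tsum fun i => ?_)
      rw [← ofReal_measureReal]
      exact ENNReal.ofReal_le_ofReal (hbound i)
    filter_upwards [ae_eventually_notMem hsum] with ω hω
    filter_upwards [hω] with n hn
    exact (not_le.mp hn).le
  have hall := ae_all_iff.mpr fun m : ℕ => hfix (1 / ((m : ℝ) + 1)) (by positivity)
  filter_upwards [hall] with ω hω ε hε
  obtain ⟨m, hm⟩ := exists_nat_one_div_lt hε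
  filter_upwards [hω m] with n hn
  exact hn.trans (Real.exp_le_exp.mpr (by gcongr))

end Growth

/-! ### A local Gärtner–Ellis theorem. -/

section GartnerEllis

variable {d : ℕ} {Q : ℕ → Measure (EuclideanSpace ℝ (Fin d))}
  {Λ : EuclideanSpace ℝ (Fin d) → ℝ} {r : ℝ}

/-- The limit of `log ∫ exp (n ⟨θ, y⟩) dQ_n / n` is `Λ θ` for `θ` in the ball of radius `r`. -/
def HasLogMGFLimit (Q : ℕ → Measure (EuclideanSpace ℝ (Fin d)))
    (Λ : EuclideanSpace ℝ (Fin d) → ℝ) (r : ℝ) : Prop :=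
  ∀ θ, ‖θ‖ < r → ∀ ε : ℝ, 0 < ε → ∀ᶠ n : ℕ in atTop,
    ENNReal.ofReal (Real.exp (n * (Λ θ - ε)))
        ≤ ∫⁻ y, ENNReal.ofReal (Real.exp (n * inner ℝ θ y)) ∂Q n ∧
      ∫⁻ y, ENNReal.ofReal (Real.exp (n * inner ℝ θ y)) ∂Q n
        ≤ ENNReal.ofReal (Real.exp (n * (Λ θ + ε)))

theorem exp_coe_mul_natCast (b : ℝ) (n : ℕ) :
    EReal.exp ((b : EReal) * n) = ENNReal.ofReal (Real.exp (n * b)) := by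
  rw [show ((n : ℕ) : EReal) = ((n : ℝ) : EReal) by rfl, ← EReal.coe_mul, EReal.exp_coe, mul_comm]

/-- Exponential Chebyshev: `⟨θ, ·⟩` drops by at most `r ε` below its value at the centre. -/
theorem expGrowthSup_ball_le (h : HasLogMGFLimit Q Λ r) {θ y : EuclideanSpace ℝ (Fin d)}
    (hθ : ‖θ‖ < r) {ε : ℝ} (hε : 0 < ε) :
    ExpGrowth.expGrowthSup (fun n => Q n (Metric.ball y ε))
      ≤ ((-(inner ℝ θ y - Λ θ) + (r + 1) * ε : ℝ) : EReal) := by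
  refine Eventually.expGrowthSup_le ?_
  filter_upwards [h θ hθ ε hε] with n hn
  rw [exp_coe_mul_natCast]
  set c : ℝ := n * (inner ℝ θ y - r * ε) with hc
  have hr : 0 ≤ r := (norm_nonneg θ).trans hθ.le
  have hmono : Metric.ball y ε ⊆ {x | ENNReal.ofReal (Real.exp c)
      ≤ ENNReal.ofReal (Real.exp (n * inner ℝ θ x))} := by
    intro x hx
    refine ENNReal.ofReal_le_ofReal (Real.exp_le_exp.mpr ?_)
    refine mul_le_mul_of_nonneg_left ?_ (Nat.cast_nonneg n)
    have h1 : inner ℝ θ (y - x) ≤ r * ε := by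
      refine (real_inner_le_norm θ (y - x)).trans ?_
      have : ‖y - x‖ ≤ ε := by
        rw [← dist_eq_norm, dist_comm]
        exact (Metric.mem_ball.mp hx).le
      exact mul_le_mul hθ.le this (norm_nonneg _) hr
    rw [inner_sub_right] at h1
    linarith
  have hcheb := (mul_le_mul_right (measure_mono (μ := Q n) hmono)
    (ENNReal.ofReal (Real.exp c))).trans
    ((mul_meas_ge_le_lintegral (μ := Q n) (by fun_prop) _).trans hn.2)
  calc Q n (Metric.ball y ε)
      = ENNReal.ofReal (Real.exp (-c)) * (ENNReal.ofReal (Real.exp c) * Q n (Metric.ball y ε)) := by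
        rw [← mul_assoc, ← ENNReal.ofReal_mul (Real.exp_pos _).le, ← Real.exp_add]
        simp
    _ ≤ ENNReal.ofReal (Real.exp (-c)) * ENNReal.ofReal (Real.exp (n * (Λ θ + ε))) := by
        gcongr
    _ = _ := by
        rw [← ENNReal.ofReal_mul (Real.exp_pos _).le, ← Real.exp_add, hc]
        congr 2
        ring

/-- A bounded set is covered by finitely many small balls centred in it, each estimated with the `θ`
of its centre; the growth rate of a finite sum is the largest one. Boundedness replaces exponential
tightness. -/
theorem expGrowthSup_le_neg_iInf (h : HasLogMGFLimit Q Λ r)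
    {I : EuclideanSpace ℝ (Fin d) → EReal} {G : Set (EuclideanSpace ℝ (Fin d))}
    (hG : Bornology.IsBounded G)
    (hI : ∀ ξ ∈ G, ∃ θ, ‖θ‖ < r ∧ I ξ = ((inner ℝ θ ξ - Λ θ : ℝ) : EReal)) :
    ExpGrowth.expGrowthSup (fun n => Q n G) ≤ -(⨅ ξ ∈ G, I ξ) := by
  refine le_of_forall_gt_imp_ge_of_dense fun c hc => ?_
  obtain ⟨b', hb', hb'c⟩ := EReal.lt_iff_exists_real_btwn.mp hc
  obtain ⟨b, hb, hbc⟩ := EReal.lt_iff_exists_real_btwn.mp hb'c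
  refine le_trans ?_ hbc.le
  have hbb : b' < b := EReal.coe_lt_coe_iff.mp hb
  choose! θ hθ hIθ using hI
  rcases G.eq_empty_or_nonempty with rfl | ⟨ξ₀, hξ₀⟩
  · simp only [measure_empty]
    exact (ExpGrowth.expGrowthSup_zero).le.trans bot_le
  have hr : 0 < r := (norm_nonneg _).trans_lt (hθ ξ₀ hξ₀)
  set ε : ℝ := (b - b') / (r + 1) with hε
  have hε0 : 0 < ε := by
    have := sub_pos.mpr hbb
    positivity
  obtain ⟨t, htG, htf, hcover⟩ := (hG.isCompact_closure.totallyBounded.subset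
    subset_closure).exists_subset (Metric.dist_mem_uniformity hε0)
  have hsub : ∀ n, Q n G ≤ (∑ y ∈ htf.toFinset, fun n => Q n (Metric.ball y ε)) n := fun n => by
    rw [Finset.sum_apply]
    refine (measure_mono (hcover.trans ?_)).trans (measure_biUnion_finset_le htf.toFinset _)
    refine Set.iUnion₂_subset fun y hy x hx => Set.mem_iUnion₂.mpr ⟨y, by simpa using hy, ?_⟩
    simpa using hx
  refine (ExpGrowth.expGrowthSup_monotone hsub).trans ?_
  rw [ExpGrowth.expGrowthSup_sum]
  refine iSup₂_le fun y hy => ?_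
  have hyG : y ∈ G := htG (by simpa using hy)
  refine (expGrowthSup_ball_le h (hθ y hyG) hε0).trans ?_
  rw [EReal.coe_le_coe_iff]
  have h1 : -(b' : EReal) ≤ I y := by
    refine le_trans ?_ (iInf₂_le (f := fun ξ _ => I ξ) y hyG)
    rw [EReal.neg_le]
    exact hb'.le
  rw [hIθ y hyG, ← EReal.coe_neg, EReal.coe_le_coe_iff] at h1
  have h2 : (r + 1) * ε = b - b' := by
    rw [hε]
    field_simp
  linarith

/-- On the sphere of radius `r / 2`, `Λ θ - ⟨θ, ξ₀⟩` is bounded below by some `κ > 0`. For `ξ` near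
`ξ₀` the analogous function stays positive there but vanishes at `0`, so its minimum over the closed
ball is interior. Convexity of its exponential makes this local minimum global. -/
theorem exists_norm_lt_isMax {ξ₀ : EuclideanSpace ℝ (Fin d)} (hΛ : Continuous Λ) (hΛ0 : Λ 0 = 0)
    (hstrict : ∀ θ, θ ≠ 0 → inner ℝ θ ξ₀ < Λ θ)
    (hconv : ∀ ξ, ConvexOn ℝ Set.univ fun θ => Real.exp (Λ θ - inner ℝ θ ξ)) (hr : 0 < r) :
    ∃ η, 0 < η ∧ ∀ ξ ∈ Metric.ball ξ₀ η, ∃ θ, ‖θ‖ < r ∧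
      ∀ θ', inner ℝ θ' ξ - Λ θ' ≤ inner ℝ θ ξ - Λ θ := by
  set ρ := r / 2 with hρ
  have hρ0 : 0 < ρ := half_pos hr
  obtain ⟨κ, hκ0, hκ⟩ := (isCompact_sphere (0 : EuclideanSpace ℝ (Fin d)) ρ).exists_forall_le'
    (f := fun θ => Λ θ - inner ℝ θ ξ₀) (a := 0)
    (hΛ.sub (continuous_id.inner continuous_const)).continuousOn fun θ hθ => by
      have : θ ≠ 0 := by
        rintro rfl
        simp at hθ
        linarith
      linarith [hstrict θ this]
  refine ⟨κ / ρ, by positivity, fun ξ hξ => ?_⟩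
  have hc : Continuous fun θ : EuclideanSpace ℝ (Fin d) => Λ θ - inner ℝ θ ξ :=
    hΛ.sub (continuous_id.inner continuous_const)
  obtain ⟨θ, hθmem, hθ⟩ := (isCompact_closedBall (0 : EuclideanSpace ℝ (Fin d)) ρ).exists_isMinOn
    ⟨0, by simp [hρ0.le]⟩ hc.continuousOn
  have hle0 : Λ θ - inner ℝ θ ξ ≤ 0 := by
    have := hθ (show (0 : EuclideanSpace ℝ (Fin d)) ∈ Metric.closedBall 0 ρ by simp [hρ0.le])
    simpa [hΛ0] using this
  have hnot : ‖θ‖ ≠ ρ := by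
    intro hn
    have h1 := hκ θ (by simpa using hn)
    have h2 : inner ℝ θ (ξ - ξ₀) ≤ ρ * ‖ξ - ξ₀‖ := hn ▸ real_inner_le_norm θ (ξ - ξ₀)
    have h3 : ρ * ‖ξ - ξ₀‖ < κ := by
      rw [← dist_eq_norm]
      have := (lt_div_iff₀ hρ0).mp (Metric.mem_ball.mp hξ)
      linarith
    rw [inner_sub_right] at h2
    linarith
  have hlt : ‖θ‖ < ρ := lt_of_le_of_ne (by simpa using hθmem) hnot
  refine ⟨θ, by linarith, ?_⟩
  have hlocal : IsLocalMin (fun θ => Real.exp (Λ θ - inner ℝ θ ξ)) θ := by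
    have : Metric.closedBall (0 : EuclideanSpace ℝ (Fin d)) ρ ∈ nhds θ :=
      mem_of_superset (Metric.isOpen_ball.mem_nhds (by simpa using hlt))
        Metric.ball_subset_closedBall
    filter_upwards [this] with x hx
    exact Real.exp_le_exp.mpr (hθ hx)
  intro θ'
  have := IsMinOn.of_isLocalMin_of_convex_univ hlocal (hconv ξ) θ'
  rw [Real.exp_le_exp] at this
  linarith

/-- Under the tilt by `θ` the mass concentrates at `ξ`. Optimality makes `Λ(θ + t v) - t ⟨v, ξ⟩`
stationary at `t = 0`, so for small `t > 0` the gain `t δ` wins, and Chebyshev with `θ + t v` gives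
an exponentially smaller integral. -/
theorem setLIntegral_halfspace_le (h : HasLogMGFLimit Q Λ r)
    {θ ξ v : EuclideanSpace ℝ (Fin d)} (hθ : ‖θ‖ < r) (hΛ : Differentiable ℝ Λ)
    (hmax : ∀ θ', inner ℝ θ' ξ - Λ θ' ≤ inner ℝ θ ξ - Λ θ) {δ : ℝ} (hδ : 0 < δ) :
    ∃ κ : ℝ, 0 < κ ∧ ∀ᶠ n : ℕ in atTop,
      ∫⁻ y in {y | inner ℝ v ξ + δ ≤ inner ℝ v y},
          ENNReal.ofReal (Real.exp (n * inner ℝ θ y)) ∂Q n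
        ≤ ENNReal.ofReal (Real.exp (n * (Λ θ - κ))) := by
  obtain ⟨t, ht0, htr, htΛ⟩ : ∃ t : ℝ, 0 < t ∧ ‖θ + t • v‖ < r ∧
      Λ (θ + t • v) - t * inner ℝ v ξ - t * δ < Λ θ := by
    set φ : ℝ → ℝ := fun t => Λ (θ + t • v) - t * inner ℝ v ξ with hφ
    have hline : Differentiable ℝ fun t : ℝ => θ + t • v := by fun_prop
    have hdiff : DifferentiableAt ℝ φ 0 :=
      ((hΛ.comp hline).sub (by fun_prop)) 0
    have hmin : IsLocalMin φ 0 := by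
      refine Eventually.of_forall fun t => ?_
      have := hmax (θ + t • v)
      rw [inner_add_left, real_inner_smul_left] at this
      simp only [hφ, zero_smul, add_zero, zero_mul, sub_zero]
      linarith
    have hder : HasDerivAt φ 0 0 := by
      simpa only [hmin.deriv_eq_zero] using hdiff.hasDerivAt
    have hder' : HasDerivAt (fun t => φ t - t * δ) (0 - 1 * δ) 0 :=
      hder.sub ((hasDerivAt_id 0).mul_const δ)
    have hslope := hder'.tendsto_slope_zero_right
    have hneg : ∀ᶠ t : ℝ in nhdsWithin 0 (Set.Ioi 0),
        t⁻¹ • ((φ (0 + t) - (0 + t) * δ) - (φ 0 - 0 * δ)) < 0 :=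
      hslope.eventually (gt_mem_nhds (by linarith))
    have hnorm : ∀ᶠ t : ℝ in nhdsWithin 0 (Set.Ioi 0), ‖θ + t • v‖ < r := by
      refine (hline.continuous.norm.continuousAt.eventually (gt_mem_nhds ?_)).filter_mono
        nhdsWithin_le_nhds
      simpa using hθ
    obtain ⟨t, ⟨h1, h2⟩, h3⟩ := ((hneg.and hnorm).and self_mem_nhdsWithin).exists
    have ht : 0 < t := h3
    refine ⟨t, ht, h2, ?_⟩
    rw [smul_eq_mul] at h1
    have := (pos_iff_neg_of_mul_neg h1).mp (inv_pos.mpr ht)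
    simp only [hφ, zero_add, zero_smul, add_zero, zero_mul, sub_zero] at this
    linarith
  set κ : ℝ := (Λ θ - (Λ (θ + t • v) - t * inner ℝ v ξ - t * δ)) / 2 with hκ
  have hκ0 : 0 < κ := half_pos (sub_pos.mpr htΛ)
  refine ⟨κ, hκ0, ?_⟩
  filter_upwards [h (θ + t • v) htr κ hκ0] with n hn
  set c : ℝ := n * (t * (inner ℝ v ξ + δ)) with hc
  calc ∫⁻ y in {y | inner ℝ v ξ + δ ≤ inner ℝ v y},
          ENNReal.ofReal (Real.exp (n * inner ℝ θ y)) ∂Q n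
      ≤ ∫⁻ y in {y | inner ℝ v ξ + δ ≤ inner ℝ v y}, ENNReal.ofReal (Real.exp (-c)) *
          ENNReal.ofReal (Real.exp (n * inner ℝ (θ + t • v) y)) ∂Q n := by
        refine setLIntegral_mono' (measurableSet_le (by fun_prop) (by fun_prop)) fun y hy => ?_
        rw [← ENNReal.ofReal_mul (Real.exp_pos _).le, ← Real.exp_add]
        refine ENNReal.ofReal_le_ofReal (Real.exp_le_exp.mpr ?_)
        rw [inner_add_left, real_inner_smul_left, hc]
        have h1 : t * (inner ℝ v ξ + δ) ≤ t * inner ℝ v y := mul_le_mul_of_nonneg_left hy ht0.le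
        have h2 := mul_le_mul_of_nonneg_left h1 (Nat.cast_nonneg (α := ℝ) n)
        linarith
    _ ≤ ∫⁻ y, ENNReal.ofReal (Real.exp (-c)) *
          ENNReal.ofReal (Real.exp (n * inner ℝ (θ + t • v) y)) ∂Q n :=
        setLIntegral_le_lintegral _ _
    _ = ENNReal.ofReal (Real.exp (-c)) *
          ∫⁻ y, ENNReal.ofReal (Real.exp (n * inner ℝ (θ + t • v) y)) ∂Q n :=
        lintegral_const_mul' _ _ ENNReal.ofReal_ne_top
    _ ≤ ENNReal.ofReal (Real.exp (-c)) *
          ENNReal.ofReal (Real.exp (n * (Λ (θ + t • v) + κ))) := by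
        gcongr
        exact hn.2
    _ = _ := by
        rw [← ENNReal.ofReal_mul (Real.exp_pos _).le, ← Real.exp_add, hc]
        congr 2
        have : 2 * κ = Λ θ - (Λ (θ + t • v) - t * inner ℝ v ξ - t * δ) := by
          rw [hκ]
          ring
        linear_combination (n : ℝ) * this

theorem exists_coord_of_notMem_ball {ξ y : EuclideanSpace ℝ (Fin d)} {δ : ℝ} (hδ : 0 < δ)
    (hy : y ∉ Metric.ball ξ δ) : ∃ p : Fin d × Bool,
      inner ℝ (EuclideanSpace.single p.1 (if p.2 then (1 : ℝ) else -1)) ξ + δ / (d + 1)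
        ≤ inner ℝ (EuclideanSpace.single p.1 (if p.2 then (1 : ℝ) else -1)) y := by
  by_contra! hcon
  apply hy
  have hcoord : ∀ i, |y i - ξ i| ≤ δ / (d + 1) := by
    intro i
    have h1 := hcon (i, true)
    have h2 := hcon (i, false)
    simp [EuclideanSpace.inner_single_left] at h1 h2
    rw [abs_le]
    constructor <;> linarith
  rw [Metric.mem_ball, EuclideanSpace.dist_eq]
  rw [Real.sqrt_lt' hδ]
  have hd1 : (0 : ℝ) < d + 1 := by positivity
  calc ∑ i, dist (y i) (ξ i) ^ 2 ≤ ∑ _i : Fin d, (δ / (d + 1)) ^ 2 :=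
        Finset.sum_le_sum fun i _ => by
          rw [Real.dist_eq]
          exact pow_le_pow_left₀ (abs_nonneg _) (hcoord i) 2
    _ = d * (δ / (d + 1)) ^ 2 := by simp
    _ < δ ^ 2 := by
        rw [div_pow, ← mul_div_assoc, div_lt_iff₀ (by positivity)]
        have : (0 : ℝ) ≤ d := Nat.cast_nonneg d
        have h2 : (d : ℝ) < (d + 1) ^ 2 := by nlinarith
        nlinarith [pow_pos hδ 2]

/-- Tilting without changing measure: the complement of the ball lies in `2 d` half-spaces carrying
a negligible part of `∫ exp(n ⟨θ, y⟩)`, so the ball carries at least half of the lower bound for the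
full integral. There the integrand is at most `exp(n (⟨θ, ξ⟩ + r δ))`. -/
theorem neg_le_expGrowthInf_ball (h : HasLogMGFLimit Q Λ r)
    {θ ξ : EuclideanSpace ℝ (Fin d)} (hθ : ‖θ‖ < r) (hΛ : Differentiable ℝ Λ)
    (hmax : ∀ θ', inner ℝ θ' ξ - Λ θ' ≤ inner ℝ θ ξ - Λ θ) {δ : ℝ} (hδ : 0 < δ) :
    ((-(inner ℝ θ ξ - Λ θ) - (r + 1) * δ : ℝ) : EReal)
      ≤ ExpGrowth.expGrowthInf fun n => Q n (Metric.ball ξ δ) := by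
  have hr : 0 < r := (norm_nonneg _).trans_lt hθ
  refine Eventually.le_expGrowthInf ?_
  choose κ hκ0 hκ using fun p : Fin d × Bool => setLIntegral_halfspace_le h
    (v := EuclideanSpace.single p.1 (if p.2 then (1 : ℝ) else -1)) hθ hΛ hmax
    (δ := δ / (d + 1)) (by positivity)
  obtain ⟨κ', hκ'0, hκ'δ, hκ'⟩ : ∃ κ' : ℝ, 0 < κ' ∧ κ' ≤ δ / 2 ∧ ∀ p, 2 * κ' ≤ κ p := by
    have h1 : ∀ᶠ x : ℝ in nhdsWithin 0 (Set.Ioi 0), ∀ p, x ≤ κ p / 2 :=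
      eventually_all.mpr fun p => (ge_mem_nhds (half_pos (hκ0 p))).filter_mono nhdsWithin_le_nhds
    have h2 : ∀ᶠ x : ℝ in nhdsWithin 0 (Set.Ioi 0), x ≤ δ / 2 :=
      (ge_mem_nhds (half_pos hδ)).filter_mono nhdsWithin_le_nhds
    obtain ⟨x, ⟨h3, h4⟩, h5⟩ := ((h1.and h2).and self_mem_nhdsWithin).exists
    exact ⟨x, h5, h4, fun p => by linarith [h3 p]⟩
  -- Beyond `N`, the factor `exp(n κ')` outweighs twice the number of half-spaces; beyond `N'`, `n δ
  -- / 2 ≥ 1` pays for the lost factor `1 / 2`.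
  obtain ⟨N, hN⟩ := exists_nat_ge ((2 * Fintype.card (Fin d × Bool) : ℝ) / κ')
  obtain ⟨N', hN'⟩ := exists_nat_ge (2 / δ)
  filter_upwards [h θ hθ κ' hκ'0, eventually_all.mpr hκ, eventually_ge_atTop N,
    eventually_ge_atTop N', eventually_gt_atTop 0] with n hn hhalf hnN hnN' hn0
  have hn0' : (0 : ℝ) < n := by exact_mod_cast hn0
  rw [exp_coe_mul_natCast]
  set f : EuclideanSpace ℝ (Fin d) → ENNReal :=
    fun y => ENNReal.ofReal (Real.exp (n * inner ℝ θ y)) with hf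
  set x : ℝ := Real.exp (n * (Λ θ - κ')) with hx
  have hball : ∫⁻ y in Metric.ball ξ δ, f y ∂Q n
      ≤ ENNReal.ofReal (Real.exp (n * (inner ℝ θ ξ + r * δ))) * Q n (Metric.ball ξ δ) := by
    rw [← setLIntegral_const]
    refine setLIntegral_mono' Metric.isOpen_ball.measurableSet fun y hy => ?_
    refine ENNReal.ofReal_le_ofReal (Real.exp_le_exp.mpr ?_)
    refine mul_le_mul_of_nonneg_left ?_ hn0'.le
    have h1 : inner ℝ θ (y - ξ) ≤ r * δ := by
      refine (real_inner_le_norm θ (y - ξ)).trans ?_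
      have : ‖y - ξ‖ ≤ δ := by
        rw [← dist_eq_norm]
        exact (Metric.mem_ball.mp hy).le
      exact mul_le_mul hθ.le this (norm_nonneg _) hr.le
    rw [inner_sub_right] at h1
    linarith
  have hcompl : ∫⁻ y in (Metric.ball ξ δ)ᶜ, f y ∂Q n ≤ ENNReal.ofReal (x / 2) := by
    calc ∫⁻ y in (Metric.ball ξ δ)ᶜ, f y ∂Q n
        ≤ ∫⁻ y in ⋃ p : Fin d × Bool,
            {y | inner ℝ (EuclideanSpace.single p.1 (if p.2 then (1 : ℝ) else -1)) ξ + δ / (d + 1)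
              ≤ inner ℝ (EuclideanSpace.single p.1 (if p.2 then (1 : ℝ) else -1)) y}, f y ∂Q n :=
          lintegral_mono_set fun y hy =>
            Set.mem_iUnion.mpr (exists_coord_of_notMem_ball hδ hy)
      _ ≤ ∑' p : Fin d × Bool, ∫⁻ y in
            {y | inner ℝ (EuclideanSpace.single p.1 (if p.2 then (1 : ℝ) else -1)) ξ + δ / (d + 1)
              ≤ inner ℝ (EuclideanSpace.single p.1 (if p.2 then (1 : ℝ) else -1)) y}, f y ∂Q n :=
          lintegral_iUnion_le _ _
      _ ≤ ∑' p : Fin d × Bool, ENNReal.ofReal (Real.exp (n * (Λ θ - 2 * κ'))) := by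
          refine ENNReal.tsum_le_tsum fun p => (hhalf p).trans ?_
          refine ENNReal.ofReal_le_ofReal (Real.exp_le_exp.mpr ?_)
          exact mul_le_mul_of_nonneg_left (by linarith [hκ' p]) hn0'.le
      _ = ENNReal.ofReal (Fintype.card (Fin d × Bool) * Real.exp (n * (Λ θ - 2 * κ'))) := by
          rw [tsum_fintype, Finset.sum_const, Finset.card_univ, nsmul_eq_mul,
            ENNReal.ofReal_mul (Nat.cast_nonneg _), ENNReal.ofReal_natCast]
      _ ≤ ENNReal.ofReal (x / 2) := by
          refine ENNReal.ofReal_le_ofReal ?_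
          have e1 : x = Real.exp (n * κ') * Real.exp (n * (Λ θ - 2 * κ')) := by
            rw [hx, ← Real.exp_add]
            congr 1
            ring
          have h1 : (2 * Fintype.card (Fin d × Bool) : ℝ) ≤ Real.exp (n * κ') := by
            have h2 : (2 * Fintype.card (Fin d × Bool) : ℝ) / κ' ≤ n :=
              hN.trans (by exact_mod_cast hnN)
            rw [div_le_iff₀ hκ'0] at h2
            linarith [Real.add_one_le_exp (n * κ')]
          have h3 := mul_le_mul_of_nonneg_right h1 (Real.exp_pos (n * (Λ θ - 2 * κ'))).le
          rw [e1]
          linarith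
  have hsplit : ENNReal.ofReal (x / 2) ≤ ∫⁻ y in Metric.ball ξ δ, f y ∂Q n := by
    have h1 := hn.1
    rw [← lintegral_add_compl _ (Metric.isOpen_ball (x := ξ) (ε := δ)).measurableSet] at h1
    have h2 : ENNReal.ofReal (x / 2) + ENNReal.ofReal (x / 2)
        ≤ ∫⁻ y in Metric.ball ξ δ, f y ∂Q n + ENNReal.ofReal (x / 2) := by
      rw [← ENNReal.ofReal_add (by positivity) (by positivity), add_halves]
      exact h1.trans (add_le_add le_rfl hcompl)
    exact (ENNReal.add_le_add_iff_right ENNReal.ofReal_ne_top).mp h2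
  set c : ℝ := n * (inner ℝ θ ξ + r * δ) with hc
  calc ENNReal.ofReal (Real.exp (n * (-(inner ℝ θ ξ - Λ θ) - (r + 1) * δ)))
      ≤ ENNReal.ofReal (Real.exp (-c)) * ENNReal.ofReal (x / 2) := by
        rw [← ENNReal.ofReal_mul (Real.exp_pos _).le]
        refine ENNReal.ofReal_le_ofReal ?_
        have h1 : Real.exp (-1) ≤ 1 / 2 := by
          rw [Real.exp_neg, one_div]
          refine inv_anti₀ two_pos ?_
          linarith [Real.add_one_le_exp (1 : ℝ)]
        have h2 : (1 : ℝ) ≤ n * (δ / 2) := by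
          have h3 : 2 / δ ≤ n := hN'.trans (by exact_mod_cast hnN')
          rw [div_le_iff₀ hδ] at h3
          linarith
        have h3 := mul_le_mul_of_nonneg_left hκ'δ hn0'.le
        calc Real.exp (n * (-(inner ℝ θ ξ - Λ θ) - (r + 1) * δ))
            ≤ Real.exp (-c + n * (Λ θ - κ') + -1) := by
              refine Real.exp_le_exp.mpr ?_
              rw [hc]
              linarith
          _ = Real.exp (-c) * (x * Real.exp (-1)) := by
              rw [Real.exp_add, Real.exp_add, hx, mul_assoc]
          _ ≤ Real.exp (-c) * (x * (1 / 2)) := by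
              gcongr
          _ = Real.exp (-c) * (x / 2) := by ring
    _ ≤ ENNReal.ofReal (Real.exp (-c)) * (ENNReal.ofReal (Real.exp c) * Q n (Metric.ball ξ δ)) := by
        gcongr
        exact hsplit.trans hball
    _ = Q n (Metric.ball ξ δ) := by
        rw [← mul_assoc, ← ENNReal.ofReal_mul (Real.exp_pos _).le, ← Real.exp_add]
        simp

/-- A local Gärtner–Ellis theorem. -/
theorem ldpOn_of_hasLogMGFLimit (h : HasLogMGFLimit Q Λ r) (hΛ : Differentiable ℝ Λ)
    (hΛ0 : Λ 0 = 0) {ξ₀ : EuclideanSpace ℝ (Fin d)} {η : ℝ}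
    (hmax : ∀ ξ ∈ Metric.ball ξ₀ η, ∃ θ, ‖θ‖ < r ∧
      ∀ θ', inner ℝ θ' ξ - Λ θ' ≤ inner ℝ θ ξ - Λ θ) :
    LDPOn Q (fun ξ => ⨆ θ, ((inner ℝ θ ξ - Λ θ : ℝ) : EReal)) (Metric.ball ξ₀ η) where
  nonneg ξ _ := le_iSup_of_le 0 (by simp [hΛ0])
  lowerSemicontinuousOn := by
    refine (lowerSemicontinuous_iSup fun θ => Continuous.lowerSemicontinuous ?_).lowerSemicontinuousOn _
    exact continuous_coe_real_ereal.comp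
      ((continuous_const.inner continuous_id).sub continuous_const)
  lower_bound G _ hG := by
    rw [EReal.neg_le]
    refine le_iInf₂ fun ξ hξ => ?_
    obtain ⟨θ, hθ, hθmax⟩ := hmax ξ (hG (interior_subset hξ))
    have hIξ : (⨆ θ, ((inner ℝ θ ξ - Λ θ : ℝ) : EReal)) = ((inner ℝ θ ξ - Λ θ : ℝ) : EReal) :=
      le_antisymm (iSup_le fun θ' => EReal.coe_le_coe_iff.mpr (hθmax θ'))
        (le_iSup (fun θ : EuclideanSpace ℝ (Fin d) => ((inner ℝ θ ξ - Λ θ : ℝ) : EReal)) θ)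
    rw [hIξ, EReal.neg_le, ← EReal.coe_neg]
    refine le_of_forall_lt_imp_le_of_dense fun c hc => ?_
    obtain ⟨b, hcb, hb⟩ := EReal.lt_iff_exists_real_btwn.mp hc
    refine hcb.le.trans ?_
    have hb' : b < -(inner ℝ θ ξ - Λ θ) := EReal.coe_lt_coe_iff.mp hb
    have hr : 0 < r := (norm_nonneg _).trans_lt hθ
    obtain ⟨δ₀, hδ₀, hδG⟩ := Metric.mem_nhds_iff.mp (mem_interior_iff_mem_nhds.mp hξ)
    set δ := min δ₀ ((-(inner ℝ θ ξ - Λ θ) - b) / (r + 1)) with hδ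
    have hδ0 : 0 < δ := lt_min hδ₀ (div_pos (by linarith) (by linarith))
    have hδb : (r + 1) * δ ≤ -(inner ℝ θ ξ - Λ θ) - b := by
      have := min_le_right δ₀ ((-(inner ℝ θ ξ - Λ θ) - b) / (r + 1))
      rw [← hδ, le_div_iff₀ (by linarith)] at this
      linarith
    refine le_trans ?_ ((neg_le_expGrowthInf_ball h hθ hΛ hθmax hδ0).trans
      (ExpGrowth.expGrowthInf_monotone fun n => measure_mono
        ((Metric.ball_subset_ball (min_le_left _ _)).trans hδG)))
    rw [EReal.coe_le_coe_iff]
    linarith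
  upper_bound G _ hG := by
    refine (expGrowthSup_le_neg_iInf h (Metric.isBounded_ball.subset hG) (I := fun ξ =>
      ⨆ θ, ((inner ℝ θ ξ - Λ θ : ℝ) : EReal)) fun ξ hξ => ?_).trans ?_
    · obtain ⟨θ, hθ, hθmax⟩ := hmax ξ (hG hξ)
      exact ⟨θ, hθ, le_antisymm (iSup_le fun θ' => EReal.coe_le_coe_iff.mpr (hθmax θ'))
        (le_iSup (fun θ : EuclideanSpace ℝ (Fin d) => ((inner ℝ θ ξ - Λ θ : ℝ) : EReal)) θ)⟩
    · rw [EReal.neg_le_neg_iff]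
      exact biInf_mono fun ξ hξ => ⟨subset_closure hξ, hG hξ⟩

end GartnerEllis

/-! ### The averaged logarithmic moment generating function. -/

section LogMGF

variable {d : ℕ} {P : Measure (Env d)}

theorem norm_toReal_le_one (z : U d) : ‖toReal (z : Fin d → ℤ)‖ ≤ 1 := by
  have hz : ∑ i, |(z : Fin d → ℤ) i| = 1 := (mem_U _).mp z.2
  rw [EuclideanSpace.norm_eq]
  refine Real.sqrt_le_one.mpr ?_
  have h1 : ∀ i, |(z : Fin d → ℤ) i| ≤ 1 := fun i => by
    rw [← hz]
    exact Finset.single_le_sum (f := fun i => |(z : Fin d → ℤ) i|) (fun j _ => abs_nonneg _)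
      (Finset.mem_univ i)
  calc ∑ i, ‖toReal (z : Fin d → ℤ) i‖ ^ 2 ≤ ∑ i, |((z : Fin d → ℤ) i : ℝ)| :=
        Finset.sum_le_sum fun i _ => by
          have h2 : |((z : Fin d → ℤ) i : ℝ)| ≤ 1 := by exact_mod_cast h1 i
          simp only [toReal, Real.norm_eq_abs]
          nlinarith [abs_nonneg ((z : Fin d → ℤ) i : ℝ)]
    _ = 1 := by exact_mod_cast hz

theorem expWeight_le_mul (θ θ' : EuclideanSpace ℝ (Fin d)) (z : U d) :
    expWeight θ z ≤ Real.exp ‖θ - θ'‖ * expWeight θ' z := by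
  rw [expWeight, expWeight, ← Real.exp_add, Real.exp_le_exp]
  have h1 := real_inner_le_norm (θ - θ') (toReal (z : Fin d → ℤ))
  have h2 := mul_le_mul_of_nonneg_left (norm_toReal_le_one z) (norm_nonneg (θ - θ'))
  rw [inner_sub_left] at h1
  linarith

/-- Steps have norm at most one, so the logarithm of the partition function is `n`-Lipschitz in `θ`,
uniformly in `ω`. -/
theorem partition_expWeight_le (ω : Env d) (θ θ' : EuclideanSpace ℝ (Fin d)) (n : ℕ) :
    partition ω (expWeight θ) n 0 0
      ≤ Real.exp (n * ‖θ - θ'‖) * partition ω (expWeight θ') n 0 0 := by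
  refine (partition_mono (fun z => (Real.exp_pos _).le) (expWeight_le_mul θ θ') n 0 0).trans ?_
  rw [partition_smul, Real.exp_nat_mul]

/-- The moment generating function `exp ∘ Λ_c`. -/
def mgf (P : Measure (Env d)) (θ : EuclideanSpace ℝ (Fin d)) : ℝ :=
  ∑ z : U d, q P z * expWeight θ z

theorem continuous_expWeight (z : U d) :
    Continuous fun θ : EuclideanSpace ℝ (Fin d) => expWeight θ z :=
  Real.continuous_exp.comp (continuous_id.inner continuous_const)

theorem continuous_mgf : Continuous (mgf P) :=
  continuous_finsetSum _ fun z _ => continuous_const.mul (continuous_expWeight z)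

theorem expWeight_zero (z : U d) : expWeight (0 : EuclideanSpace ℝ (Fin d)) z = 1 := by
  simp [expWeight]

theorem mgf_zero (hq1 : ∑ z, q P z = 1) : mgf P 0 = 1 := by
  simp only [mgf, expWeight_zero, mul_one, hq1]

theorem mgf_pos [Nonempty (U d)] (hq : ∀ z, 0 < q P z) (θ : EuclideanSpace ℝ (Fin d)) :
    0 < mgf P θ :=
  Finset.sum_pos (fun z _ => mul_pos (hq z) (Real.exp_pos _)) Finset.univ_nonempty

theorem exp_logMGF [Nonempty (U d)] (hq : ∀ z, 0 < q P z) (θ : EuclideanSpace ℝ (Fin d)) :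
    Real.exp (logMGF P θ) = mgf P θ :=
  Real.exp_log (mgf_pos hq θ)

theorem differentiable_logMGF [Nonempty (U d)] (hq : ∀ z, 0 < q P z) :
    Differentiable ℝ (logMGF P) := by
  have h1 : Differentiable ℝ (mgf P) := by
    unfold mgf expWeight
    refine Differentiable.fun_sum fun z _ => ?_
    exact ((differentiable_id.inner ℝ (differentiable_const _)).exp).const_mul _
  exact h1.log fun θ => (mgf_pos hq θ).ne'

theorem logMGF_zero (hq1 : ∑ z, q P z = 1) : logMGF P 0 = 0 := by
  simp only [logMGF, inner_zero_left, Real.exp_zero, mul_one, hq1, Real.log_one]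

/-- The exponential is a positive combination of exponentials of linear functions, which avoids
convexity of the logarithm itself. -/
theorem convexOn_exp_logMGF_sub [Nonempty (U d)] (hq : ∀ z, 0 < q P z)
    (ξ : EuclideanSpace ℝ (Fin d)) :
    ConvexOn ℝ Set.univ fun θ => Real.exp (logMGF P θ - inner ℝ θ ξ) := by
  have e : ∀ θ, Real.exp (logMGF P θ - inner ℝ θ ξ)
      = ∑ z : U d, q P z * Real.exp (inner ℝ θ (toReal (z : Fin d → ℤ) - ξ)) := fun θ => by
    rw [Real.exp_sub, exp_logMGF hq, mgf, Finset.sum_div]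
    refine Finset.sum_congr rfl fun z _ => ?_
    rw [inner_sub_right, Real.exp_sub, expWeight, mul_div_assoc]
  simp_rw [e]
  refine ⟨convex_univ, fun x _ y _ a b ha hb hab => ?_⟩
  rw [smul_eq_mul, smul_eq_mul, Finset.mul_sum, Finset.mul_sum, ← Finset.sum_add_distrib]
  refine Finset.sum_le_sum fun z _ => ?_
  have := convexOn_exp.2 (Set.mem_univ (inner ℝ x (toReal (z : Fin d → ℤ) - ξ)))
    (Set.mem_univ (inner ℝ y (toReal (z : Fin d → ℤ) - ξ))) ha hb hab
  rw [inner_add_left, real_inner_smul_left, real_inner_smul_left]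
  simp only [smul_eq_mul] at this
  have h2 := mul_le_mul_of_nonneg_left this (hq z).le
  linarith

/-- Strict Jensen: if `θ i ≠ 0`, then `⟨θ, ·⟩` takes different values at `e_i` and `-e_i`. -/
theorem inner_limitVelocity_lt [Nonempty (U d)] (hq : ∀ z, 0 < q P z) (hq1 : ∑ z, q P z = 1)
    {θ : EuclideanSpace ℝ (Fin d)} (hθ : θ ≠ 0) :
    inner ℝ θ (limitVelocity P) < logMGF P θ := by
  refine (Real.lt_log_iff_exp_lt (mgf_pos hq θ)).mpr ?_
  obtain ⟨i, hi⟩ : ∃ i, θ i ≠ 0 := by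
    by_contra! h
    exact hθ (by ext i; simpa using h i)
  have key := strictConvexOn_exp.map_sum_lt (t := Finset.univ) (w := q P)
    (p := fun z : U d => inner ℝ θ (toReal (z : Fin d → ℤ))) (fun z _ => hq z) hq1
    (fun _ _ => Set.mem_univ _)
    ⟨⟨Pi.single i 1, single_mem_U i (by simp)⟩, Finset.mem_univ _,
      ⟨Pi.single i (-1), single_mem_U i (by simp)⟩, Finset.mem_univ _, by
        have h1 : ∀ s : ℤ, toReal (Pi.single i s : Fin d → ℤ)
            = EuclideanSpace.single i (s : ℝ) := fun s => by
          ext j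
          rcases eq_or_ne j i with rfl | hj
          · simp [toReal]
          · simp [toReal, hj]
        simp only [h1, EuclideanSpace.inner_single_right]
        simp
        intro h
        apply hi
        linarith⟩
  simp only [smul_eq_mul] at key
  rw [limitVelocity, inner_sum]
  simp_rw [real_inner_smul_right]
  exact key

end LogMGF

/-! ### Almost sure limits for all small tilts. -/

section Main

variable {d : ℕ} {P : Measure (Env d)}

theorem ae_forall_le_env
    (hident : ∀ (n : ℤ) (x : Fin d → ℤ),
      IdentDistrib (fun ω : Env d => ω n x) (fun ω => ω 0 0) P P)
    {c : ℝ} (hc : ∀ z : U d, ∀ᵐ ω ∂P, c ≤ ω 0 0 z) :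
    ∀ᵐ ω ∂P, ∀ k x z, c ≤ ω k x z := by
  simp_rw [ae_all_iff]
  exact fun k x z => (hident k x).symm.ae_snd (p := fun a : SiteEnv d => c ≤ a z)
    (measurableSet_le measurable_const (measurable_siteEnv_apply z)) (hc z)

variable [IsProbabilityMeasure P]

theorem integrable_env_apply (z : U d) : Integrable (fun ω : Env d => ω 0 0 z) P :=
  integrable_of_nonneg_of_le (measurable_env_apply 0 0 z) (fun ω => env_nonneg ω 0 0 z)
    (fun ω => env_le_one ω 0 0 z)

theorem integrable_env_apply_mul (z w : U d) :
    Integrable (fun ω : Env d => ω 0 0 z * ω 0 0 w) P :=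
  integrable_of_nonneg_of_le ((measurable_env_apply 0 0 z).mul (measurable_env_apply 0 0 w))
    (fun ω => mul_nonneg (env_nonneg ω 0 0 z) (env_nonneg ω 0 0 w)) (C := 1)
    (fun ω => mul_le_one₀ (env_le_one ω 0 0 z) (env_nonneg ω 0 0 w) (env_le_one ω 0 0 w))

theorem q_pos {c : ℝ} (hc0 : 0 < c) (hc : ∀ z : U d, ∀ᵐ ω ∂P, c ≤ ω 0 0 z) (z : U d) :
    0 < q P z := by
  refine hc0.trans_le ?_
  have := integral_mono_ae (integrable_const c) (integrable_env_apply z) (hc z)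
  rwa [integral_const, probReal_univ, one_smul] at this

theorem sum_q : ∑ z, q P z = 1 := by
  simp only [q]
  rw [← integral_finsetSum _ fun z _ => integrable_env_apply z]
  simp only [stdSimplex.sum_eq_one, integral_const, probReal_univ, one_smul]

theorem integral_mul_pos {c : ℝ} (hc0 : 0 < c) (hc : ∀ z : U d, ∀ᵐ ω ∂P, c ≤ ω 0 0 z)
    (z w : U d) : 0 < ∫ ω, ω 0 0 z * ω 0 0 w ∂P := by
  refine (mul_pos hc0 hc0).trans_le ?_
  have := integral_mono_ae (integrable_const (c * c)) (integrable_env_apply_mul (P := P) z w) (by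
    filter_upwards [hc z, hc w] with ω h1 h2
    exact mul_le_mul h1 h2 hc0.le (env_nonneg ω 0 0 z))
  simpa using this

theorem sum_integral_mul : ∑ z : U d, ∑ w : U d, ∫ ω : Env d, ω 0 0 z * ω 0 0 w ∂P = 1 := by
  simp_rw [← integral_finsetSum _ fun w _ => integrable_env_apply_mul (P := P) _ w]
  rw [← integral_finsetSum _ fun z _ => integrable_finsetSum _ fun w _ =>
    integrable_env_apply_mul z w]
  simp only [← Finset.sum_mul_sum, stdSimplex.sum_eq_one, mul_one, integral_const,
    probReal_univ, one_smul]

theorem ae_eventually_exp_le_partition (hd : 3 ≤ d)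
    (hindep : iIndepFun (fun (p : ℤ × (Fin d → ℤ)) (ω : Env d) => ω p.1 p.2) P)
    (hident : ∀ (n : ℤ) (x : Fin d → ℤ),
      IdentDistrib (fun ω : Env d => ω n x) (fun ω => ω 0 0) P P)
    {c : ℝ} (hc0 : 0 < c) (hc : ∀ z : U d, ∀ᵐ ω ∂P, c ≤ ω 0 0 z) :
    ∃ r : ℝ, 0 < r ∧ ∀ θ, ‖θ‖ < r → ∀ᵐ ω ∂P, ∀ ε : ℝ, 0 < ε → ∀ᶠ n : ℕ in atTop,
      Real.exp (n * (logMGF P θ - ε)) ≤ partition ω (expWeight θ) n 0 0 ∧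
      partition ω (expWeight θ) n 0 0 ≤ Real.exp (n * (logMGF P θ + ε)) := by
  let i : Fin d := ⟨0, by omega⟩
  let z₀ : U d := ⟨Pi.single i 1, single_mem_U i (by simp)⟩
  let w₀ : U d := ⟨Pi.single i (-1), single_mem_U i (by simp)⟩
  have hzw : z₀ ≠ w₀ := by
    intro h
    have := congrFun (congrArg Subtype.val h) i
    simp [z₀, w₀] at this
  have : Nonempty (U d) := ⟨z₀⟩
  have hq := q_pos (P := P) hc0 hc
  have hq1 : ∑ z, q P z = 1 := sum_q
  obtain ⟨M, hM, A, hA, hev⟩ := exists_superharmonic hd hq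
    (fun z w => integral_mul_pos (P := P) hc0 hc z w) sum_integral_mul
  -- Normalised weights have mean one under `q` and tend to `1` as `θ → 0`, which is where
  -- `exists_superharmonic` applies.
  set e : EuclideanSpace ℝ (Fin d) → U d → ℝ := fun θ z => (mgf P θ)⁻¹ * expWeight θ z with he
  have hcont : Continuous e := continuous_pi fun z =>
    (continuous_mgf.inv₀ fun θ => (mgf_pos hq θ).ne').mul (continuous_expWeight z)
  have he0 : e 0 = 1 := by
    ext z
    simp [he, mgf_zero hq1, expWeight_zero]
  have hev' := (hcont.tendsto 0).eventually (he0 ▸ hev)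
  obtain ⟨r, hr, hball⟩ := Metric.eventually_nhds_iff_ball.mp hev'
  refine ⟨r, hr, fun θ hθ => ?_⟩
  have hepos : ∀ z, 0 < e θ z := fun z => mul_pos (inv_pos.mpr (mgf_pos hq θ)) (Real.exp_pos _)
  have hqe : ∑ z, q P z * e θ z = 1 := by
    have : ∀ z, q P z * e θ z = (mgf P θ)⁻¹ * (q P z * expWeight θ z) := fun z => by
      simp only [he]; ring
    simp_rw [this]
    rw [← Finset.mul_sum]
    exact inv_mul_cancel₀ (mgf_pos hq θ).ne'
  obtain ⟨hg1, hg0⟩ := hball θ (by simpa using hθ) hqe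
  obtain ⟨z₁, hz₁⟩ := Finite.exists_min (e θ)
  set a := min 1 (c * e θ z₁) with ha
  have ha0 : 0 < a := lt_min one_pos (mul_pos hc0 (hepos z₁))
  have hnn : ∀ z, 0 ≤ e θ z := fun z => (hepos z).le
  have hZ : ∀ (ω : Env d) (n : ℕ), partition ω (expWeight θ) n 0 0
      = Real.exp (n * logMGF P θ) * partition ω (e θ) n 0 0 := fun ω n => by
    simp only [he]
    rw [partition_smul, Real.exp_nat_mul, exp_logMGF hq, ← mul_assoc, ← mul_pow,
      mul_inv_cancel₀ (mgf_pos hq θ).ne', one_pow, one_mul]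
  filter_upwards [ae_forall_le_env hident hc,
    ae_eventually_grid hindep hident hnn hqe hM hA hg1 hg0 hzw,
    ae_eventually_partition_le hindep hident hnn hqe] with ω hω hgrid hup ε hε
  have hlow := exp_le_partition_of_grid ha0 (min_le_left _ _) hnn
    (fun k x z => (min_le_right _ _).trans
      (mul_le_mul (hω k x z) (hz₁ z) (hnn z₁) (env_nonneg ω k x z))) z₀ w₀ hgrid hε
  filter_upwards [hlow, hup ε hε] with n h1 h2
  rw [hZ]
  constructor
  · rw [show (n : ℝ) * (logMGF P θ - ε) = n * logMGF P θ + -(ε * n) by ring, Real.exp_add]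
    gcongr
  · rw [show (n : ℝ) * (logMGF P θ + ε) = n * logMGF P θ + ε * n by ring, Real.exp_add]
    gcongr

/-- The exceptional null set depends on `θ`. A dense sequence leaves one null set, and the Lipschitz
bound with continuity of `Λ_c` extends the limit to every `θ` in the ball. -/
theorem ae_hasLogMGFLimit (hd : 3 ≤ d)
    (hindep : iIndepFun (fun (p : ℤ × (Fin d → ℤ)) (ω : Env d) => ω p.1 p.2) P)
    (hident : ∀ (n : ℤ) (x : Fin d → ℤ),
      IdentDistrib (fun ω : Env d => ω n x) (fun ω => ω 0 0) P P)
    {c : ℝ} (hc0 : 0 < c) (hc : ∀ z : U d, ∀ᵐ ω ∂P, c ≤ ω 0 0 z)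
    (hΛ : Continuous (logMGF P)) :
    ∃ r : ℝ, 0 < r ∧ ∀ᵐ ω ∂P, HasLogMGFLimit (velocityLaw ω) (logMGF P) r := by
  obtain ⟨r, hr, h⟩ := ae_eventually_exp_le_partition hd hindep hident hc0 hc
  refine ⟨r, hr, ?_⟩
  set u := TopologicalSpace.denseSeq (EuclideanSpace ℝ (Fin d)) with hu
  have hall : ∀ᵐ ω ∂P, ∀ m, ‖u m‖ < r → ∀ ε : ℝ, 0 < ε → ∀ᶠ n : ℕ in atTop,
      Real.exp (n * (logMGF P (u m) - ε)) ≤ partition ω (expWeight (u m)) n 0 0 ∧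
      partition ω (expWeight (u m)) n 0 0 ≤ Real.exp (n * (logMGF P (u m) + ε)) := by
    rw [ae_all_iff]
    intro m
    by_cases hm : ‖u m‖ < r
    · filter_upwards [h (u m) hm] with ω hω _ using hω
    · exact Eventually.of_forall fun ω hm' => absurd hm' hm
  filter_upwards [hall] with ω hω θ hθ ε hε
  have hopen : ∀ᶠ θ' in nhds θ, ‖θ'‖ < r ∧ ‖θ - θ'‖ < ε / 3 ∧
      |logMGF P θ' - logMGF P θ| < ε / 3 := by
    refine (continuous_norm.continuousAt.eventually (gt_mem_nhds hθ)).and (Eventually.and ?_ ?_)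
    · exact (continuous_const.sub continuous_id).norm.continuousAt.eventually
        (gt_mem_nhds (by simpa using by linarith))
    · exact ((hΛ.sub continuous_const).abs).continuousAt.eventually
        (gt_mem_nhds (by simpa using by linarith))
  obtain ⟨m, hm1, hm2, hm3⟩ : ∃ m, ‖u m‖ < r ∧ ‖θ - u m‖ < ε / 3 ∧
      |logMGF P (u m) - logMGF P θ| < ε / 3 := by
    obtain ⟨_, ⟨m, rfl⟩, h1⟩ := (TopologicalSpace.denseRange_denseSeq
      (EuclideanSpace ℝ (Fin d))).inter_nhds_nonempty hopen
    exact ⟨m, h1⟩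
  obtain ⟨hm4, hm5⟩ := abs_lt.mp hm3
  filter_upwards [hω m hm1 (ε / 3) (by linarith), eventually_gt_atTop 0] with n hn hn0
  have hn0' : (0 : ℝ) ≤ n := Nat.cast_nonneg n
  rw [lintegral_velocityLaw_exp θ hn0.ne']
  constructor
  · refine ENNReal.ofReal_le_ofReal ?_
    have h1 := hn.1.trans (partition_expWeight_le ω (u m) θ n)
    rw [norm_sub_rev] at h1
    have h2 : Real.exp (n * (logMGF P θ - ε)) * Real.exp (n * ‖θ - u m‖)
        ≤ Real.exp (n * (logMGF P (u m) - ε / 3)) := by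
      rw [← Real.exp_add, Real.exp_le_exp, ← mul_add]
      exact mul_le_mul_of_nonneg_left (by linarith) hn0'
    have h3 := h2.trans h1
    rw [mul_comm (Real.exp (n * ‖θ - u m‖))] at h3
    exact le_of_mul_le_mul_right h3 (Real.exp_pos _)
  · refine ENNReal.ofReal_le_ofReal ?_
    calc partition ω (expWeight θ) n 0 0
        ≤ Real.exp (n * ‖θ - u m‖) * partition ω (expWeight (u m)) n 0 0 :=
          partition_expWeight_le ω θ (u m) n
      _ ≤ Real.exp (n * ‖θ - u m‖) * Real.exp (n * (logMGF P (u m) + ε / 3)) := by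
          gcongr
          exact hn.2
      _ ≤ Real.exp (n * (logMGF P θ + ε)) := by
          rw [← Real.exp_add, Real.exp_le_exp, ← mul_add]
          exact mul_le_mul_of_nonneg_left (by linarith) hn0'

end Main

end SpaceTimeRWRE

end

theorem theorem1p16 (d : ℕ) (hd : 3 ≤ d)
    (P : Measure (SpaceTimeRWRE.Env d)) [IsProbabilityMeasure P]
    (hindep : iIndepFun (fun (p : ℤ × (Fin d → ℤ)) (ω : SpaceTimeRWRE.Env d) => ω p.1 p.2) P)
    (hident : ∀ (n : ℤ) (x : Fin d → ℤ),
      IdentDistrib (fun ω : SpaceTimeRWRE.Env d => ω n x) (fun ω => ω 0 0) P P)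
    (hell : ∃ c : ℝ, 0 < c ∧ ∀ z : SpaceTimeRWRE.U d,
      ∀ᵐ ω ∂P, c ≤ ω 0 0 z) :
    ∃ η : ℝ, 0 < η ∧ ∀ᵐ ω ∂P,
      SpaceTimeRWRE.LDPOn (SpaceTimeRWRE.velocityLaw ω) (SpaceTimeRWRE.cramerRate P)
        (Metric.ball (SpaceTimeRWRE.limitVelocity P) η) := by
  obtain ⟨c, hc0, hc⟩ := hell
  have : Nonempty (SpaceTimeRWRE.U d) :=
    ⟨⟨Pi.single ⟨0, by omega⟩ 1, SpaceTimeRWRE.single_mem_U _ (by simp)⟩⟩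
  have hq := SpaceTimeRWRE.q_pos hc0 hc
  have hq1 : ∑ z, SpaceTimeRWRE.q P z = 1 := SpaceTimeRWRE.sum_q
  have hdiff := SpaceTimeRWRE.differentiable_logMGF hq
  have h0 := SpaceTimeRWRE.logMGF_zero hq1
  obtain ⟨r, hr, hlim⟩ :=
    SpaceTimeRWRE.ae_hasLogMGFLimit hd hindep hident hc0 hc hdiff.continuous
  obtain ⟨η, hη, hmax⟩ := SpaceTimeRWRE.exists_norm_lt_isMax hdiff.continuous h0
    (fun θ hθ => SpaceTimeRWRE.inner_limitVelocity_lt hq hq1 hθ)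
    (SpaceTimeRWRE.convexOn_exp_logMGF_sub hq) hr
  refine ⟨η, hη, ?_⟩
  filter_upwards [hlim] with ω hω
  exact SpaceTimeRWRE.ldpOn_of_hasLogMGFLimit hω hdiff h0 hmax
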